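/- **Theorem (finite termination of the phase 1 trust funnel algorithm).** Let $f:\mathbb R^N\to\mathbb R$ and $c:\mathbb R^N\to\mathbb R^M$ be twice continuously differentiable, with $g=\nabla f$ and $J$ the Jacobian of $c$. Put $v(x)=\frac12\|c(x)\|^2$, $g^v=J^Tc$, $H^v=J^TJ+\sum_i c_i\nabla^2c_i$; a subscript $k$ denotes evaluation at $x_k$. Let $m^v_k(d)=v_k+(g^v_k)^Td+\frac12d^TH^v_kd$ and, for symmetric matrices $H_k$, $m^f_k(d)=f_k+g_k^Td+\frac12d^TH_kd$. *Parameters.* $\kappa_n,\kappa_{vm},\kappa_{tn},\kappa_\rho,\kappa_{fm},\kappa_{st},\kappa_{ntt},\kappa_{v1},\kappa_{v2},\gamma_c\in(0,1)$; $\kappa_p,\kappa_{ht},\kappa_{hs},\epsilon,\underline\sigma>0$; $\kappa_\delta,\gamma_e,\gamma_\lambda>1$; $\overline\sigma\ge\underline\sigma$. *Initialization.* $x_0\in\mathbb R^N$, $v^{\max}_0\ge\max\{1,v_0\}$, $\sigma^v_0\in[\underline\sigma,\overline\sigma]$, $0<\delta^v_0\le\Delta^v_0$, $\delta^f_0>0$.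 *Iteration $k=0,1,2,\dots$.* If $\|g^v_k\|\le\epsilon$, return $x_k$ and stop. Otherwise: 1. *Normal step.* Let $(n_k,\lambda^v_k)$ be a primal-dual solution of $\min m^v_k(n)$ s.t. $\|n\|\le\delta^v_k$: $n_k$ is a global minimizer, $g^v_k+(H^v_k+\lambda^v_kI)n_k=0$, $H^v_k+\lambda^v_kI\succeq0$, $\lambda^v_k\ge0$, $\lambda^v_k(\delta^v_k-\|n_k\|)=0$. 2. *Tangential step.* Let $\delta^s_k=\min\{\kappa_\delta\delta^v_k,\delta^f_k\}$ and let $g^p_k$ be the orthogonal projection of $g_k+H_kn_k$ onto $\mathrm{Null}(J_k)$. If $\|n_k\|\le\kappa_n\delta^s_k$ and $\|g^p_k\|\ge\kappa_p\|g^v_k\|$, let $(t_k,y_k,\lambda^f_k)$ be a primal-dual solution of $\min m^f_k(n_k+t)$ s.t. $J_kt=0$, $\|n_k+t\|\le\delta^s_k$: $t_k$ is a global minimizer, $(H_k+\lambda^f_kI)t_k+J_k^Ty_k=-(g_k+(H_k+\lambda^f_kI)n_k)$, $H_k+\lambda^f_kI\succeq0$ on $\mathrm{Null}(J_k)$, $\lambda^f_k\ge0$,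 $\lambda^f_k(\delta^s_k-\|n_k+t_k\|)=0$. If then any of $m^v_k(0)-m^v_k(n_k+t_k)\ge\kappa_{vm}(m^v_k(0)-m^v_k(n_k))$, $\|n_k+t_k\|\ge\kappa_{tn}\|n_k\|$, $\|H^v_kt_k\|\le\kappa_{ht}\|n_k+t_k\|^2$ fails, reset $(t_k,\lambda^f_k)=(0,0)$. If no tangential step is computed, $(t_k,\lambda^f_k)=(0,0)$. Put $s_k=n_k+t_k$. 3. *Ratio.* For $k\ge1$: if iteration $k-1$ was a V-iteration with $\rho^v_{k-1}<\kappa_\rho$, set $\sigma^v_k=\max\{\sigma^v_{k-1},\lambda^v_k/\|n_k\|\}$; otherwise $\sigma^v_k=\sigma^v_{k-1}$. 4. Iteration $k$ is an *F-iteration* if $t_k\ne0$, $\|t_k\|\ge\kappa_{st}\|s_k\|$, $m^f_k(0)-m^f_k(s_k)\ge\kappa_{fm}(m^f_k(n_k)-m^f_k(s_k))$, $v(x_k+s_k)\le v^{\max}_k-\kappa_\rho\|s_k\|^3$, $n_k^Tt_k\ge-\frac12\kappa_{ntt}\|t_k\|^2$, $\lambda^v_k\le\sigma^v_k\|n_k\|$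 and $\|(H_k-\nabla^2f(x_k))s_k\|\le\kappa_{hs}\|s_k\|^2$; otherwise it is a *V-iteration*. 5. *F-iteration.* Let $\rho^f_k=(f_k-f(x_k+s_k))/\|s_k\|^3$, and set $\delta^v_{k+1}=\delta^v_k$, $\Delta^v_{k+1}=\Delta^v_k$. - If $\rho^f_k\ge\kappa_\rho$ (accept): $x_{k+1}=x_k+s_k$, $v^{\max}_{k+1}=\min\{\max\{\kappa_{v1}v^{\max}_k,v^{\max}_k-\kappa_\rho\|s_k\|^3\},\,v_{k+1}+\kappa_{v2}(v^{\max}_k-v_{k+1})\}$, $\delta^f_{k+1}=\max\{\delta^f_k,\gamma_e\|s_k\|\}$. - Otherwise (reject): $x_{k+1}=x_k$, $v^{\max}_{k+1}=v^{\max}_k$. If $\lambda^f_k<\underline\sigma\|s_k\|$, choose $\lambda>\lambda^f_k$ such that the minimizer $t(\lambda)$ of $(g_k+(H_k+\lambda I)n_k)^Tt+\frac12t^T(H_k+\lambda I)t$ over $J_kt=0$ satisfies $\underline\sigma\le\lambda/\|n_k+t(\lambda)\|$, and set $\delta^f_{k+1}=\|n_k+t(\lambda)\|$; else $\delta^f_{k+1}=\gamma_c\|s_k\|$.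 6. *V-iteration.* Let $\rho^v_k=(v_k-v(x_k+s_k))/\|s_k\|^3$, and set $\delta^f_{k+1}=\delta^f_k$. Let $n(\lambda)$ denote the minimizer of $v_k+(g^v_k)^Tn+\frac12n^T(H^v_k+\lambda I)n$. - If $\rho^v_k\ge\kappa_\rho$ and ($\lambda^v_k\le\sigma^v_k\|n_k\|$ or $\|n_k\|=\Delta^v_k$) (accept): $x_{k+1}=x_k+s_k$, $v^{\max}_{k+1}=\min\{\max\{\kappa_{v1}v^{\max}_k,v_{k+1}+\kappa_{v2}(v_k-v_{k+1})\},\,v_{k+1}+\kappa_{v2}(v^{\max}_k-v_{k+1})\}$, $\Delta^v_{k+1}=\max\{\Delta^v_k,\gamma_e\|n_k\|\}$, $\delta^v_{k+1}=\min\{\Delta^v_{k+1},\max\{\delta^v_k,\gamma_e\|n_k\|\}\}$. - In the other two cases $x_{k+1}=x_k$, $v^{\max}_{k+1}=v^{\max}_k$, $\Delta^v_{k+1}=\Delta^v_k$. - If $\rho^v_k<\kappa_\rho$ (contract): when $\lambda^v_k<\underline\sigma\|n_k\|$, let $\hat\lambda=\lambda^v_k+(\underline\sigma\|g^v_k\|)^{1/2}$;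 if $\hat\lambda/\|n(\hat\lambda)\|\le\overline\sigma$ set $\delta^v_{k+1}=\|n(\hat\lambda)\|$, else choose $\lambda\in(\lambda^v_k,\hat\lambda)$ with $\underline\sigma\le\lambda/\|n(\lambda)\|\le\overline\sigma$ and set $\delta^v_{k+1}=\|n(\lambda)\|$. When $\lambda^v_k\ge\underline\sigma\|n_k\|$, set $\delta^v_{k+1}=\max\{\|n(\gamma_\lambda\lambda^v_k)\|,\gamma_c\|n_k\|\}$. - Otherwise (expand): $\delta^v_{k+1}=\min\{\Delta^v_{k+1},\lambda^v_k/\sigma^v_k\}$. *Assumptions.* The iterates $x_k$ lie in a compact set, and the norms $\|H_k\|$ are bounded. Moreover, after an F-iteration whose step is rejected (so that $x_{k+1}=x_k$ and $\delta^v_{k+1}=\delta^v_k$), the matrix and the normal step are kept: $H_{k+1}=H_k$ and $n_{k+1}=n_k$. *Conclusion.* For every sequence generated by the algorithm, the set $\mathcal I$ of iterations $k$ with $\|J_k^Tc_k\|>\epsilon$ is finite, i.e. the algorithm terminates after finitely many iterations: there is a $K$ with $\mathcal I=\{k:k<K\}$. -/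

import Mathlib

noncomputable section

namespace TrustFunnel

/-- The Euclidean space `ℝⁿ`. -/
abbrev Vec (n : ℕ) : Type := EuclideanSpace ℝ (Fin n)

/-- `N × N` real matrices, as linear operators on `ℝᴺ` (the norm is the spectral norm). -/
abbrev Op (N : ℕ) : Type := Vec N →L[ℝ] Vec N

/-- The parameters required by the algorithm, with their ranges. -/
structure Params where
  kn : ℝ
  kvm : ℝ
  ktn : ℝ
  krho : ℝ
  kfm : ℝ
  kst : ℝ
  kntt : ℝ
  kv1 : ℝ
  kv2 : ℝ
  gc : ℝ
  kp : ℝ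
  kht : ℝ
  khs : ℝ
  eps : ℝ
  sigMin : ℝ
  sigMax : ℝ
  kdelta : ℝ
  ge : ℝ
  glam : ℝ
  kn_mem : kn ∈ Set.Ioo (0 : ℝ) 1
  kvm_mem : kvm ∈ Set.Ioo (0 : ℝ) 1
  ktn_mem : ktn ∈ Set.Ioo (0 : ℝ) 1
  krho_mem : krho ∈ Set.Ioo (0 : ℝ) 1
  kfm_mem : kfm ∈ Set.Ioo (0 : ℝ) 1
  kst_mem : kst ∈ Set.Ioo (0 : ℝ) 1
  kntt_mem : kntt ∈ Set.Ioo (0 : ℝ) 1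
  kv1_mem : kv1 ∈ Set.Ioo (0 : ℝ) 1
  kv2_mem : kv2 ∈ Set.Ioo (0 : ℝ) 1
  gc_mem : gc ∈ Set.Ioo (0 : ℝ) 1
  kp_pos : 0 < kp
  kht_pos : 0 < kht
  khs_pos : 0 < khs
  eps_pos : 0 < eps
  sigMin_pos : 0 < sigMin
  sigMin_le : sigMin ≤ sigMax
  one_lt_kdelta : 1 < kdelta
  one_lt_ge : 1 < ge
  one_lt_glam : 1 < glam

/-- The quantities generated by the algorithm, indexed by the iteration counter:
iterates `x`, symmetric matrices `H`, normal and tangential steps `n`, `t`, the dual variables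
`lamV`, `lamF` of the two trust region constraints, the trust funnel radii `vmax`, the trust region
radii `dV` (normal), `dMaxV` (its upper bound) and `dF` (objective), and the ratios `sig`. -/
structure Trace (N : ℕ) where
  x : ℕ → Vec N
  H : ℕ → Op N
  n : ℕ → Vec N
  t : ℕ → Vec N
  lamV : ℕ → ℝ
  lamF : ℕ → ℝ
  vmax : ℕ → ℝ
  dV : ℕ → ℝ
  dMaxV : ℕ → ℝ
  dF : ℕ → ℝ
  sig : ℕ → ℝ

/-- The full trial step `s = n + t`. -/
def Trace.s {N : ℕ} (R : Trace N) (k : ℕ) : Vec N := R.n k + R.t k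

/-- The trust region radius `min {kdelta * dV, dF}` of the tangential subproblem. -/
def Trace.dS {N : ℕ} (R : Trace N) (p : Params) (k : ℕ) : ℝ := min (p.kdelta * R.dV k) (R.dF k)

section Models

variable {N M : ℕ}

/-- The Hessian of a real-valued function: the derivative of its gradient. -/
def hess (f : Vec N → ℝ) (x : Vec N) : Op N := fderiv ℝ (gradient f) x

/-- The Jacobian of the constraint function. -/
def jac (c : Vec N → Vec M) (x : Vec N) : Vec N →L[ℝ] Vec M := fderiv ℝ c x

/-- The transposed Jacobian. -/
def jacT (c : Vec N → Vec M) (x : Vec N) : Vec M →L[ℝ] Vec N :=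
  ContinuousLinearMap.adjoint (jac c x)

/-- The infeasibility measure `v = ½ ‖c‖²`. -/
def infeas (c : Vec N → Vec M) (x : Vec N) : ℝ := 1 / 2 * ‖c x‖ ^ 2

/-- The gradient `Jᵀ c` of the infeasibility measure. -/
def gradV (c : Vec N → Vec M) (x : Vec N) : Vec N := jacT c x (c x)

/-- The Hessian `Jᵀ J + ∑ᵢ cᵢ ∇²cᵢ` of the infeasibility measure. -/
def hessV (c : Vec N → Vec M) (x : Vec N) : Op N :=
  (jacT c x).comp (jac c x) + ∑ i : Fin M, c x i • hess (fun z => c z i) x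

/-- The second-order Taylor model of the infeasibility measure at `x`. -/
def modelV (c : Vec N → Vec M) (x d : Vec N) : ℝ :=
  infeas c x + inner ℝ (gradV c x) d + 1 / 2 * inner ℝ d (hessV c x d)

/-- The quadratic model of the objective at `x` with matrix `H`. -/
def modelF (f : Vec N → ℝ) (x : Vec N) (H : Op N) (d : Vec N) : ℝ :=
  f x + inner ℝ (gradient f x) d + 1 / 2 * inner ℝ d (H d)

/-- `(n, lam)` is a primal-dual solution of `min modelV` subject to `‖n‖ ≤ r`. -/
def NormalSolution (c : Vec N → Vec M) (x : Vec N) (r : ℝ) (n : Vec N) (lam : ℝ) : Prop :=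
  ‖n‖ ≤ r ∧
  (∀ d : Vec N, ‖d‖ ≤ r → modelV c x n ≤ modelV c x d) ∧
  gradV c x + (hessV c x n + lam • n) = 0 ∧
  (∀ d : Vec N, 0 ≤ inner ℝ d (hessV c x d + lam • d)) ∧
  0 ≤ lam ∧
  lam * (r - ‖n‖) = 0

/-- `n` solves the regularized normal subproblem `Q^v(lam)`. -/
def SolvesQV (c : Vec N → Vec M) (x : Vec N) (lam : ℝ) (n : Vec N) : Prop :=
  ∀ d : Vec N,
    infeas c x + inner ℝ (gradV c x) n + 1 / 2 * inner ℝ n (hessV c x n + lam • n) ≤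
      infeas c x + inner ℝ (gradV c x) d + 1 / 2 * inner ℝ d (hessV c x d + lam • d)

/-- The orthogonal projection `Z Zᵀ (g + H n)` of the model gradient onto `Null J`, where the
columns of `Z` are an orthonormal basis of `Null J`. -/
def projGrad (f : Vec N → ℝ) (c : Vec N → Vec M) (x : Vec N) (H : Op N) (n : Vec N) : Vec N :=
  (LinearMap.ker (jac c x : Vec N →ₗ[ℝ] Vec M)).starProjection (gradient f x + H n)

/-- `(t, y, lam)` is a primal-dual solution of `min modelF (n + t)` subject to `J t = 0` and
`‖n + t‖ ≤ r`. The condition that `Zᵀ H Z + lam I` is positive semidefinite is written as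
nonnegativity of the quadratic form of `H + lam I` on `Null J`. -/
def TangentialSolution (f : Vec N → ℝ) (c : Vec N → Vec M) (x : Vec N) (H : Op N) (n : Vec N)
    (r : ℝ) (t : Vec N) (y : Vec M) (lam : ℝ) : Prop :=
  jac c x t = 0 ∧
  ‖n + t‖ ≤ r ∧
  (∀ d : Vec N, jac c x d = 0 → ‖n + d‖ ≤ r → modelF f x H (n + t) ≤ modelF f x H (n + d)) ∧
  H t + lam • t + jacT c x y = -(gradient f x + (H n + lam • n)) ∧
  (∀ d : Vec N, jac c x d = 0 → 0 ≤ inner ℝ d (H d + lam • d)) ∧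
  0 ≤ lam ∧
  lam * (r - ‖n + t‖) = 0

/-- `t` solves the regularized tangential subproblem `Q^f(lam)`. -/
def SolvesQF (f : Vec N → ℝ) (c : Vec N → Vec M) (x : Vec N) (H : Op N) (n : Vec N)
    (lam : ℝ) (t : Vec N) : Prop :=
  jac c x t = 0 ∧
  ∀ d : Vec N, jac c x d = 0 →
    inner ℝ (gradient f x + (H n + lam • n)) t + 1 / 2 * inner ℝ t (H t + lam • t) ≤
      inner ℝ (gradient f x + (H n + lam • n)) d + 1 / 2 * inner ℝ d (H d + lam • d)

/-- The three conditions under which a computed tangential step is kept. -/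
def KeepTangential (p : Params) (c : Vec N → Vec M) (x n t : Vec N) : Prop :=
  p.kvm * (modelV c x 0 - modelV c x n) ≤ modelV c x 0 - modelV c x (n + t) ∧
  p.ktn * ‖n‖ ≤ ‖n + t‖ ∧
  ‖hessV c x t‖ ≤ p.kht * ‖n + t‖ ^ 2

end Models

section Algorithm

variable {N M : ℕ} (p : Params) (f : Vec N → ℝ) (c : Vec N → Vec M) (R : Trace N) (k : ℕ)

/-- The procedure computing `(n, t, lamV, lamF)` at iteration `k`. -/
def ComputeSteps : Prop :=
  NormalSolution c (R.x k) (R.dV k) (R.n k) (R.lamV k) ∧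
  ((‖R.n k‖ ≤ p.kn * R.dS p k ∧
      p.kp * ‖gradV c (R.x k)‖ ≤ ‖projGrad f c (R.x k) (R.H k) (R.n k)‖) →
    ∃ (t : Vec N) (y : Vec M) (lam : ℝ),
      TangentialSolution f c (R.x k) (R.H k) (R.n k) (R.dS p k) t y lam ∧
      (KeepTangential p c (R.x k) (R.n k) t → R.t k = t ∧ R.lamF k = lam) ∧
      (¬ KeepTangential p c (R.x k) (R.n k) t → R.t k = 0 ∧ R.lamF k = 0)) ∧
  (¬ (‖R.n k‖ ≤ p.kn * R.dS p k ∧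
      p.kp * ‖gradV c (R.x k)‖ ≤ ‖projGrad f c (R.x k) (R.H k) (R.n k)‖) →
    R.t k = 0 ∧ R.lamF k = 0)

/-- Iteration `k` is an F-iteration (otherwise it is a V-iteration). -/
def IsFIteration : Prop :=
  R.t k ≠ 0 ∧
  p.kst * ‖R.s k‖ ≤ ‖R.t k‖ ∧
  p.kfm * (modelF f (R.x k) (R.H k) (R.n k) - modelF f (R.x k) (R.H k) (R.s k)) ≤
    modelF f (R.x k) (R.H k) 0 - modelF f (R.x k) (R.H k) (R.s k) ∧
  infeas c (R.x k + R.s k) ≤ R.vmax k - p.krho * ‖R.s k‖ ^ 3 ∧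
  -(1 / 2) * p.kntt * ‖R.t k‖ ^ 2 ≤ inner ℝ (R.n k) (R.t k) ∧
  R.lamV k ≤ R.sig k * ‖R.n k‖ ∧
  ‖(R.H k - hess f (R.x k)) (R.s k)‖ ≤ p.khs * ‖R.s k‖ ^ 2

/-- The ratio `ρᶠ` of objective decrease to the cube of the step norm. -/
def rhoF : ℝ := (f (R.x k) - f (R.x k + R.s k)) / ‖R.s k‖ ^ 3

/-- The ratio `ρᵛ` of infeasibility decrease to the cube of the step norm. -/
def rhoV : ℝ := (infeas c (R.x k) - infeas c (R.x k + R.s k)) / ‖R.s k‖ ^ 3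

/-- The update of `sig` on entering iteration `k + 1`. -/
def ComputeSigma : Prop :=
  (IsFIteration p f c R k → R.sig (k + 1) = R.sig k) ∧
  (¬ IsFIteration p f c R k →
    (rhoV c R k < p.krho →
      R.sig (k + 1) = max (R.sig k) (R.lamV (k + 1) / ‖R.n (k + 1)‖)) ∧
    (p.krho ≤ rhoV c R k → R.sig (k + 1) = R.sig k))

/-- The contraction of the objective trust region radius. -/
def FContract : Prop :=
  (R.lamF k < p.sigMin * ‖R.s k‖ →
    ∃ (lam : ℝ) (t : Vec N), R.lamF k < lam ∧
      SolvesQF f c (R.x k) (R.H k) (R.n k) lam t ∧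
      p.sigMin ≤ lam / ‖R.n k + t‖ ∧
      R.dF (k + 1) = ‖R.n k + t‖) ∧
  (p.sigMin * ‖R.s k‖ ≤ R.lamF k → R.dF (k + 1) = p.gc * ‖R.s k‖)

/-- The updates made by an F-iteration. -/
def FUpdate : Prop :=
  R.dV (k + 1) = R.dV k ∧
  R.dMaxV (k + 1) = R.dMaxV k ∧
  (p.krho ≤ rhoF f R k →
    R.x (k + 1) = R.x k + R.s k ∧
    R.vmax (k + 1) =
      min (max (p.kv1 * R.vmax k) (R.vmax k - p.krho * ‖R.s k‖ ^ 3))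
        (infeas c (R.x (k + 1)) + p.kv2 * (R.vmax k - infeas c (R.x (k + 1)))) ∧
    R.dF (k + 1) = max (R.dF k) (p.ge * ‖R.s k‖)) ∧
  (rhoF f R k < p.krho →
    R.x (k + 1) = R.x k ∧
    R.vmax (k + 1) = R.vmax k ∧
    FContract p f c R k)

/-- The contraction of the normal trust region radius. -/
def VContract : Prop :=
  (R.lamV k < p.sigMin * ‖R.n k‖ →
    ∃ (lamHat : ℝ) (nHat : Vec N),
      lamHat = R.lamV k + Real.sqrt (p.sigMin * ‖gradV c (R.x k)‖) ∧
      SolvesQV c (R.x k) lamHat nHat ∧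
      (lamHat / ‖nHat‖ ≤ p.sigMax → R.dV (k + 1) = ‖nHat‖) ∧
      (p.sigMax < lamHat / ‖nHat‖ →
        ∃ (lam : ℝ) (n : Vec N), R.lamV k < lam ∧ lam < lamHat ∧
          SolvesQV c (R.x k) lam n ∧
          p.sigMin ≤ lam / ‖n‖ ∧ lam / ‖n‖ ≤ p.sigMax ∧
          R.dV (k + 1) = ‖n‖)) ∧
  (p.sigMin * ‖R.n k‖ ≤ R.lamV k →
    ∃ n : Vec N, SolvesQV c (R.x k) (p.glam * R.lamV k) n ∧
      (p.gc * ‖R.n k‖ ≤ ‖n‖ → R.dV (k + 1) = ‖n‖) ∧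
      (‖n‖ < p.gc * ‖R.n k‖ → R.dV (k + 1) = p.gc * ‖R.n k‖))

/-- The acceptance test of a V-iteration. -/
def VAccept : Prop :=
  p.krho ≤ rhoV c R k ∧ (R.lamV k ≤ R.sig k * ‖R.n k‖ ∨ ‖R.n k‖ = R.dMaxV k)

/-- The updates made by a V-iteration: accept, contract, or expand. -/
def VUpdate : Prop :=
  R.dF (k + 1) = R.dF k ∧
  (VAccept p c R k →
    R.x (k + 1) = R.x k + R.s k ∧
    R.vmax (k + 1) =
      min (max (p.kv1 * R.vmax k)
          (infeas c (R.x (k + 1)) + p.kv2 * (infeas c (R.x k) - infeas c (R.x (k + 1)))))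
        (infeas c (R.x (k + 1)) + p.kv2 * (R.vmax k - infeas c (R.x (k + 1)))) ∧
    R.dMaxV (k + 1) = max (R.dMaxV k) (p.ge * ‖R.n k‖) ∧
    R.dV (k + 1) = min (R.dMaxV (k + 1)) (max (R.dV k) (p.ge * ‖R.n k‖))) ∧
  (rhoV c R k < p.krho →
    R.x (k + 1) = R.x k ∧
    R.vmax (k + 1) = R.vmax k ∧
    R.dMaxV (k + 1) = R.dMaxV k ∧
    VContract p c R k) ∧
  (¬ VAccept p c R k → p.krho ≤ rhoV c R k →
    R.x (k + 1) = R.x k ∧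
    R.vmax (k + 1) = R.vmax k ∧
    R.dMaxV (k + 1) = R.dMaxV k ∧
    R.dV (k + 1) = min (R.dMaxV (k + 1)) (R.lamV k / R.sig k))

/-- Iteration `k` is an F-iteration whose trial step is rejected. -/
def RejectedFIteration : Prop := IsFIteration p f c R k ∧ rhoF f R k < p.krho

end Algorithm

/-- The iterations `k` with `‖Jᵀ c‖ > eps` at `x k`, i.e. those at which the algorithm does not
return. -/
def activeSet {N M : ℕ} (p : Params) (c : Vec N → Vec M) (R : Trace N) : Set ℕ :=
  {k : ℕ | p.eps < ‖jacT c (R.x k) (c (R.x k))‖}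

/-- `R` is generated by the phase 1 trust funnel algorithm. When the stopping test holds at
iteration `k`, the algorithm returns `x k`; the returned point is repeated for all later indices, and
no other quantity is computed any more. -/
structure IsRun {N M : ℕ} (p : Params) (f : Vec N → ℝ) (c : Vec N → Vec M) (R : Trace N) :
    Prop where
  vmax_init : max 1 (infeas c (R.x 0)) ≤ R.vmax 0
  sig_init : R.sig 0 ∈ Set.Icc p.sigMin p.sigMax
  dV_init : 0 < R.dV 0
  dMaxV_init : 0 < R.dMaxV 0
  dF_init : 0 < R.dF 0
  dV_le_init : R.dV 0 ≤ R.dMaxV 0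
  stopped : ∀ k, k ∉ activeSet p c R → R.x (k + 1) = R.x k
  symm : ∀ k ∈ activeSet p c R, IsSelfAdjoint (R.H k)
  steps : ∀ k ∈ activeSet p c R, ComputeSteps p f c R k
  sigma : ∀ k, k + 1 ∈ activeSet p c R → ComputeSigma p f c R k
  fIteration : ∀ k ∈ activeSet p c R, IsFIteration p f c R k → FUpdate p f c R k
  vIteration : ∀ k ∈ activeSet p c R, ¬ IsFIteration p f c R k → VUpdate p c R k

end TrustFunnel

end

/-! Suppose the algorithm never stops, so `‖gradV‖ > eps` throughout. The Cauchy decrease of the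
normal model is linear in `dV`, while the error of the model is quadratic, so contraction cannot
occur at small radii. Hence `dV` stays away from zero, `‖n‖ ≥ r > 0` and `lamV ≤ L`
(`exists_normal_bounds`). Every accepted step, of either type, lowers `vmax ≥ v ≥ 0` by a fixed
amount, so only finitely many steps are accepted (`eventually_not_accepted`); the decrease of `f`
plays no role.

It remains to exclude an infinite tail of rejections. Rejected F-iterations alone would keep
shrinking `dF`, contradicting `r ≤ ‖n‖ ≤ kn * dF` (`exists_not_rejected`), so V-iterations recur.
After one rejected V-iteration the condition blocking expansion holds forever (`normalTest_after`,
`normalTest_succ`), so each later V-iteration contracts. Rejected F-iterations keep `lamV / ‖n‖`,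
whereas from the second contraction on each multiplies it by at least `min glam gc⁻¹ > 1`
(`ratio_after_contract`). This contradicts `lamV / ‖n‖ ≤ L / r`.

Both subproblems are treated as one regularized quadratic problem, `RegMin`; monotonicity of the
step norm in the multiplier supplies the comparisons. -/

namespace TrustFunnel

/-! ### Regularized quadratics on a subspace: step norm versus multiplier. -/

section RegularizedMinimizers

variable {E : Type*} [NormedAddCommGroup E] [InnerProductSpace ℝ E]

/-- `t` minimizes `⟪g, b + t⟫ + ½ ⟪b + t, A (b + t)⟫ + ½ lam ‖b + t‖²` over the subspace `W`
(up to an additive constant, for symmetric `A`). -/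
def RegMin (g : E) (A : E →L[ℝ] E) (W : Submodule ℝ E) (b : E) (lam : ℝ) (t : E) : Prop :=
  t ∈ W ∧ ∀ d ∈ W,
    inner ℝ (g + (A b + lam • b)) t + 1 / 2 * inner ℝ t (A t + lam • t) ≤
      inner ℝ (g + (A b + lam • b)) d + 1 / 2 * inner ℝ d (A d + lam • d)

variable {g : E} {A : E →L[ℝ] E} {W : Submodule ℝ E} {b : E}

theorem reg_objective_add (hA : ∀ u w, inner ℝ (A u) w = inner ℝ u (A w)) (h t d : E) (lam : ℝ) :
    inner ℝ h (t + d) + 1 / 2 * inner ℝ (t + d) (A (t + d) + lam • (t + d)) =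
      inner ℝ h t + 1 / 2 * inner ℝ t (A t + lam • t) + inner ℝ (h + (A t + lam • t)) d +
        1 / 2 * inner ℝ d (A d + lam • d) := by
  have h1 : inner ℝ t (A d) = inner ℝ (A t) d := (hA t d).symm
  have h2 : inner ℝ d (A t) = inner ℝ (A t) d := real_inner_comm _ _
  have h3 : inner ℝ d t = inner ℝ t d := real_inner_comm _ _
  simp only [map_add, smul_add, inner_add_left, inner_add_right, inner_smul_left, inner_smul_right,
    h1, h2, h3, RCLike.conj_to_real]
  ring

theorem regMin_of_stationary (hA : ∀ u w, inner ℝ (A u) w = inner ℝ u (A w)) {lam : ℝ} {t : E}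
    (ht : t ∈ W) (hs : ∀ d ∈ W, inner ℝ (g + (A b + lam • b) + (A t + lam • t)) d = 0)
    (hpsd : ∀ d ∈ W, 0 ≤ inner ℝ d (A d + lam • d)) : RegMin g A W b lam t := by
  refine ⟨ht, fun d hd => ?_⟩
  have h := reg_objective_add hA (g + (A b + lam • b)) t (d - t) lam
  rw [add_sub_cancel, hs _ (W.sub_mem hd ht)] at h
  have := hpsd _ (W.sub_mem hd ht)
  linarith

theorem RegMin.stationary (hA : ∀ u w, inner ℝ (A u) w = inner ℝ u (A w)) {lam : ℝ} {t : E}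
    (h : RegMin g A W b lam t) {d : E} (hd : d ∈ W) :
    inner ℝ (g + (A b + lam • b) + (A t + lam • t)) d = 0 := by
  set a := inner ℝ (g + (A b + lam • b) + (A t + lam • t)) d with ha
  set q := inner ℝ d (A d + lam • d) with hq
  have key : ∀ τ : ℝ, 0 ≤ τ * a + 1 / 2 * (τ ^ 2 * q) := by
    intro τ
    have h1 := h.2 (t + τ • d) (W.add_mem h.1 (W.smul_mem τ hd))
    rw [reg_objective_add hA] at h1
    have h2 : inner ℝ (τ • d) (A (τ • d) + lam • (τ • d)) = τ ^ 2 * q := by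
      rw [map_smul, smul_comm lam τ d, ← smul_add, inner_smul_left, inner_smul_right, hq]
      simp only [RCLike.conj_to_real]
      ring
    rw [h2, inner_smul_right, ← ha] at h1
    linarith
  have hpos : 0 < |q| + 1 := by positivity
  -- The denominator dominates the curvature `q`, whatever its sign, so the linear term wins at this
  -- `τ`.
  have h1 := key (-a / (|q| + 1))
  have h2 : -a / (|q| + 1) * a + 1 / 2 * ((-a / (|q| + 1)) ^ 2 * q) =
      a ^ 2 / (|q| + 1) ^ 2 * (1 / 2 * q - (|q| + 1)) := by
    field_simp
    ring
  rw [h2] at h1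
  by_contra hne
  have h3 : 0 < a ^ 2 / (|q| + 1) ^ 2 := by positivity
  have h4 : 1 / 2 * q - (|q| + 1) < 0 := by
    have := le_abs_self q
    have := abs_nonneg q
    linarith
  linarith [mul_neg_of_pos_of_neg h3 h4]

/-- The parameter enters only as a penalty on the full step `b + t`, which makes minimizers for
different parameters comparable without symmetry or definiteness of `A`. -/
theorem reg_objective_eq (b t : E) (lam : ℝ) :
    inner ℝ (g + (A b + lam • b)) t + 1 / 2 * inner ℝ t (A t + lam • t) =
      inner ℝ (g + A b) t + 1 / 2 * inner ℝ t (A t) + lam / 2 * (‖b + t‖ ^ 2 - ‖b‖ ^ 2) := by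
  rw [norm_add_sq_real]
  simp only [inner_add_left, inner_add_right, inner_smul_left, inner_smul_right,
    RCLike.conj_to_real, real_inner_self_eq_norm_sq]
  ring

/-- Adding the two optimality inequalities cancels the model and leaves `(l₂ - l₁) * (‖b + t₂‖ ^ 2 -
‖b + t₁‖ ^ 2) ≤ 0`. -/
theorem RegMin.norm_le {l₁ l₂ : ℝ} {t₁ t₂ : E} (h₁ : RegMin g A W b l₁ t₁)
    (h₂ : RegMin g A W b l₂ t₂) (hl : l₁ < l₂) : ‖b + t₂‖ ≤ ‖b + t₁‖ := by
  have e₁ := h₁.2 t₂ h₂.1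
  have e₂ := h₂.2 t₁ h₁.1
  rw [reg_objective_eq, reg_objective_eq b] at e₁ e₂
  refine le_of_sq_le_sq ?_ (norm_nonneg _)
  by_contra hlt
  push Not at hlt
  nlinarith [mul_pos (sub_pos.2 hl) (sub_pos.2 hlt)]

/-- The equality case of `RegMin.norm_le`: equal norms make `t₁` optimal for both parameters, and
subtracting the two stationarity conditions isolates `b + t₁`. Strict monotonicity follows whenever
this orthogonality is impossible. -/
theorem RegMin.orthogonal_of_norm_le (hA : ∀ u w, inner ℝ (A u) w = inner ℝ u (A w))
    {l₁ l₂ : ℝ} {t₁ t₂ : E} (h₁ : RegMin g A W b l₁ t₁)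
    (h₂ : RegMin g A W b l₂ t₂) (hl : l₁ < l₂) (hn : ‖b + t₁‖ ≤ ‖b + t₂‖) {d : E} (hd : d ∈ W) :
    inner ℝ (b + t₁) d = 0 := by
  have heq : ‖b + t₁‖ = ‖b + t₂‖ := le_antisymm hn (h₁.norm_le h₂ hl)
  have h₃ : RegMin g A W b l₂ t₁ := by
    refine ⟨h₁.1, fun d hd => ?_⟩
    have e₁ := h₁.2 t₂ h₂.1
    have e₂ := h₂.2 d hd
    rw [reg_objective_eq, reg_objective_eq b] at e₁ e₂ ⊢
    rw [heq] at e₁ ⊢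
    linarith
  have s₁ := h₁.stationary hA hd
  have s₂ := h₃.stationary hA hd
  simp only [inner_add_left, inner_smul_left, RCLike.conj_to_real] at s₁ s₂ ⊢
  have : (l₂ - l₁) * (inner ℝ b d + inner ℝ t₁ d) = 0 := by linarith
  exact (mul_eq_zero.1 this).resolve_left (sub_ne_zero.2 hl.ne')

end RegularizedMinimizers

/-! ### Derivatives of the infeasibility measure and its Taylor error. -/

section Calculus

variable {N M : ℕ}

/-- The Riesz map from functionals to gradients, as a real-linear map. -/
noncomputable def riesz (N : ℕ) : StrongDual ℝ (Vec N) →L[ℝ] Vec N :=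
  LinearMap.toContinuousLinearMap
    { toFun := (InnerProductSpace.toDual ℝ (Vec N)).symm
      map_add' := map_add _
      map_smul' := fun a l => by simp }

theorem hess_symm {f : Vec N → ℝ} (hf : ContDiff ℝ 2 f) (x u w : Vec N) :
    inner ℝ (hess f x u) w = inner ℝ u (hess f x w) := by
  have hd : DifferentiableAt ℝ (fderiv ℝ f) x :=
    (hf.fderiv_right (m := 1) (by norm_num)).differentiable (by norm_num) x
  have key : ∀ u w, inner ℝ (hess f x u) w = fderiv ℝ (fderiv ℝ f) x u w := by
    intro u w
    have h1 : HasFDerivAt (gradient f) ((riesz N).comp (fderiv ℝ (fderiv ℝ f) x)) x :=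
      (riesz N).hasFDerivAt.comp x hd.hasFDerivAt
    rw [hess, h1.fderiv]
    exact InnerProductSpace.toDual_symm_apply
  have hs : IsSymmSndFDerivAt ℝ f x :=
    hf.contDiffAt.isSymmSndFDerivAt (by simp)
  rw [real_inner_comm _ u, key, key]
  exact hs.eq u w

theorem continuous_hess {f : Vec N → ℝ} (hf : ContDiff ℝ 2 f) : Continuous (hess f) := by
  have h1 : ContDiff ℝ 1 (gradient f) :=
    (riesz N).contDiff.comp (hf.fderiv_right (m := 1) (by norm_num))
  exact h1.continuous_fderiv (by norm_num)

variable {c : Vec N → Vec M}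

theorem contDiff_coord (hc : ContDiff ℝ 2 c) (i : Fin M) : ContDiff ℝ 2 (fun z => c z i) :=
  (EuclideanSpace.proj (𝕜 := ℝ) i).contDiff.comp hc

theorem hessV_symm (hc : ContDiff ℝ 2 c) (x u w : Vec N) :
    inner ℝ (hessV c x u) w = inner ℝ u (hessV c x w) := by
  simp only [hessV, add_apply, ContinuousLinearMap.comp_apply,
    sum_apply, smul_apply, inner_add_left, inner_add_right,
    sum_inner, inner_sum, inner_smul_left, inner_smul_right, hess_symm (contDiff_coord hc _), jacT,
    ContinuousLinearMap.adjoint_inner_left, ContinuousLinearMap.adjoint_inner_right,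
    RCLike.conj_to_real]

theorem continuous_jac (hc : ContDiff ℝ 2 c) : Continuous (jac c) :=
  hc.continuous_fderiv (by norm_num)

theorem continuous_jacT (hc : ContDiff ℝ 2 c) : Continuous (jacT c) :=
  (ContinuousLinearMap.adjoint (𝕜 := ℝ) (E := Vec N) (F := Vec M)).continuous.comp
    (continuous_jac hc)

theorem continuous_gradV (hc : ContDiff ℝ 2 c) : Continuous (gradV c) :=
  (continuous_jacT hc).clm_apply hc.continuous

theorem continuous_hessV (hc : ContDiff ℝ 2 c) : Continuous (hessV c) := by
  refine ((continuous_jacT hc).clm_comp (continuous_jac hc)).add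
    (continuous_finsetSum _ fun i _ => ?_)
  exact (contDiff_coord hc i).continuous.smul (continuous_hess (contDiff_coord hc i))

theorem contDiff_infeas (hc : ContDiff ℝ 2 c) : ContDiff ℝ 2 (infeas c) :=
  contDiff_const.mul (hc.norm_sq ℝ)

theorem fderiv_infeas (hc : ContDiff ℝ 2 c) (x d : Vec N) :
    fderiv ℝ (infeas c) x d = inner ℝ (gradV c x) d := by
  have h1 : HasFDerivAt c (jac c x) x := (hc.differentiable (by norm_num) x).hasFDerivAt
  have h2 := (h1.norm_sq).const_mul (1 / 2 : ℝ)
  rw [show infeas c = fun z => 1 / 2 * ‖c z‖ ^ 2 from rfl, h2.fderiv]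
  simp [gradV, jacT, ContinuousLinearMap.adjoint_inner_left]

/-- A one-sided quadratic error suffices, since it competes with a decrease linear in the radius. So
`hessV` need not be identified with the second derivative of `infeas c`. -/
theorem exists_infeas_le_model (hc : ContDiff ℝ 2 c) {K : Set (Vec N)} (hK : IsCompact K)
    (S : ℝ) : ∃ C : ℝ, 0 ≤ C ∧ ∀ x ∈ K, ∀ s : Vec N, ‖s‖ ≤ S →
      infeas c (x + s) ≤ modelV c x s + C * ‖s‖ ^ 2 := by
  obtain ⟨r, hr⟩ := hK.isBounded.exists_norm_le
  obtain ⟨B, hB⟩ := hK.exists_bound_of_continuousOn (continuous_hessV hc).continuousOn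
  have h1 : ContDiff ℝ 1 (fderiv ℝ (infeas c)) :=
    (contDiff_infeas hc).fderiv_right (m := 1) (by norm_num)
  obtain ⟨L, hL⟩ := (isCompact_closedBall (0 : Vec N) (r + S)).exists_bound_of_continuousOn
    (h1.continuous_fderiv (by norm_num)).continuousOn
  -- `|L|` bounds the remainder after the linear term, on a ball containing all segments from `x` to
  -- `x + s`; `|B|` pays for the quadratic term of the model.
  refine ⟨|L| + |B|, by positivity, fun x hx s hs => ?_⟩
  have hxr := hr x hx
  have hball : ∀ y ∈ segment ℝ x (x + s), y ∈ Metric.closedBall (0 : Vec N) (r + S) := by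
    intro y hy
    have hS : 0 ≤ S := (norm_nonneg _).trans hs
    refine (convex_closedBall (0 : Vec N) (r + S)).segment_subset ?_ ?_ hy
    · rw [mem_closedBall_zero_iff]; linarith
    · rw [mem_closedBall_zero_iff]; linarith [norm_add_le x s]
  have hgrad : ∀ y ∈ segment ℝ x (x + s),
      ‖fderiv ℝ (infeas c) y - fderiv ℝ (infeas c) x‖ ≤ |L| * ‖s‖ := by
    intro y hy
    have h2 := (convex_segment x (x + s)).norm_image_sub_le_of_norm_hasFDerivWithin_le
      (f := fderiv ℝ (infeas c)) (f' := fun z => fderiv ℝ (fderiv ℝ (infeas c)) z) (C := |L|)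
      (fun z _ => (h1.differentiable (by norm_num) z).hasFDerivAt.hasFDerivWithinAt)
      (fun z hz => (hL z (hball z hz)).trans (le_abs_self L)) (left_mem_segment ℝ x (x + s)) hy
    refine h2.trans (mul_le_mul_of_nonneg_left ?_ (abs_nonneg _))
    obtain ⟨θ, hθ, rfl⟩ := (segment_eq_image' ℝ x (x + s)).subset hy
    simp only [add_sub_cancel_left, norm_smul, Real.norm_eq_abs, abs_of_nonneg hθ.1]
    exact mul_le_of_le_one_left (norm_nonneg _) hθ.2
  have h3 := (convex_segment x (x + s)).norm_image_sub_le_of_norm_hasFDerivWithin_le'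
      (f := infeas c) (f' := fun z => fderiv ℝ (infeas c) z) (φ := fderiv ℝ (infeas c) x)
      (fun z _ => ((contDiff_infeas hc).differentiable (by norm_num) z).hasFDerivAt.hasFDerivWithinAt)
      hgrad (left_mem_segment ℝ x (x + s)) (right_mem_segment ℝ x (x + s))
  rw [add_sub_cancel_left, fderiv_infeas hc, Real.norm_eq_abs] at h3
  have h4 := (le_abs_self _).trans h3
  have h5 : |inner ℝ s (hessV c x s)| ≤ |B| * ‖s‖ ^ 2 := by
    calc |inner ℝ s (hessV c x s)| ≤ ‖s‖ * ‖hessV c x s‖ := abs_real_inner_le_norm _ _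
      _ ≤ ‖s‖ * (|B| * ‖s‖) := by
          gcongr
          exact (ContinuousLinearMap.le_opNorm _ _).trans
            (by gcongr; exact (hB x hx).trans (le_abs_self _))
      _ = |B| * ‖s‖ ^ 2 := by ring
  have h6 := neg_le_of_abs_le h5
  have h7 : 0 ≤ |B| * ‖s‖ ^ 2 := by positivity
  unfold modelV
  linarith

end Calculus

/-! ### Normal and tangential subproblems as instances of `RegMin`. -/

section Subproblems

variable {N M : ℕ} {c : Vec N → Vec M} {x n n₁ n₂ : Vec N} {l l₁ l₂ r : ℝ}

theorem SolvesQV.regMin (h : SolvesQV c x l n) : RegMin (gradV c x) (hessV c x) ⊤ 0 l n := by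
  refine ⟨trivial, fun d _ => ?_⟩
  have := h d
  simp only [map_zero, smul_zero, add_zero]
  linarith

theorem NormalSolution.regMin (hc : ContDiff ℝ 2 c) (h : NormalSolution c x r n l) :
    RegMin (gradV c x) (hessV c x) ⊤ 0 l n := by
  obtain ⟨-, -, h3, h4, -, -⟩ := h
  refine regMin_of_stationary (hessV_symm hc x) trivial (fun d _ => ?_) fun d _ => h4 d
  rw [map_zero, smul_zero, add_zero, add_zero, h3, inner_zero_left]

theorem RegMin.normal_eq (hc : ContDiff ℝ 2 c)
    (h : RegMin (gradV c x) (hessV c x) ⊤ 0 l n) : gradV c x + (hessV c x n + l • n) = 0 := by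
  refine inner_self_eq_zero (𝕜 := ℝ).1 ?_
  simpa using h.stationary (hessV_symm hc x)
    (d := gradV c x + (hessV c x n + l • n)) trivial

theorem RegMin.norm_gradV_le (hc : ContDiff ℝ 2 c)
    (h : RegMin (gradV c x) (hessV c x) ⊤ 0 l n) {B : ℝ} (hB : ‖hessV c x‖ ≤ B) (hl : 0 ≤ l) :
    ‖gradV c x‖ ≤ (B + l) * ‖n‖ := by
  rw [eq_neg_of_add_eq_zero_left (h.normal_eq hc), norm_neg]
  calc ‖hessV c x n + l • n‖ ≤ ‖hessV c x n‖ + ‖l • n‖ := norm_add_le _ _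
    _ ≤ B * ‖n‖ + l * ‖n‖ := by
        rw [norm_smul, Real.norm_of_nonneg hl]
        gcongr
        exact (ContinuousLinearMap.le_opNorm _ _).trans (by gcongr)
    _ = (B + l) * ‖n‖ := by ring

theorem RegMin.mul_norm_le (hc : ContDiff ℝ 2 c)
    (h : RegMin (gradV c x) (hessV c x) ⊤ 0 l n) {B : ℝ} (hB : ‖hessV c x‖ ≤ B) (hl : 0 ≤ l) :
    l * ‖n‖ ≤ ‖gradV c x‖ + B * ‖n‖ := by
  have h1 : l • n = -(gradV c x + hessV c x n) := by
    rw [eq_neg_iff_add_eq_zero, ← h.normal_eq hc]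
    abel
  calc l * ‖n‖ = ‖l • n‖ := by rw [norm_smul, Real.norm_of_nonneg hl]
    _ = ‖gradV c x + hessV c x n‖ := by rw [h1, norm_neg]
    _ ≤ ‖gradV c x‖ + ‖hessV c x n‖ := norm_add_le _ _
    _ ≤ ‖gradV c x‖ + B * ‖n‖ := by
        gcongr
        exact (ContinuousLinearMap.le_opNorm _ _).trans (by gcongr)

theorem RegMin.norm_pos (hc : ContDiff ℝ 2 c)
    (h : RegMin (gradV c x) (hessV c x) ⊤ 0 l n) (hg : gradV c x ≠ 0) : 0 < ‖n‖ := by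
  rw [norm_pos_iff]
  rintro rfl
  exact hg (by simpa using h.normal_eq hc)

/-- With `b = 0` and `W = ⊤`, equality of norms would make `n₁` orthogonal to itself, which a
nonzero gradient forbids. -/
theorem RegMin.norm_lt (hc : ContDiff ℝ 2 c)
    (h₁ : RegMin (gradV c x) (hessV c x) ⊤ 0 l₁ n₁)
    (h₂ : RegMin (gradV c x) (hessV c x) ⊤ 0 l₂ n₂) (hg : gradV c x ≠ 0) (hl : l₁ < l₂) :
    ‖n₂‖ < ‖n₁‖ := by
  by_contra hle
  push Not at hle
  have := h₁.orthogonal_of_norm_le (hessV_symm hc x) h₂ hl (by simpa using hle) (d := n₁) trivial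
  rw [zero_add, real_inner_self_eq_norm_sq] at this
  have h3 := h₁.norm_pos hc hg
  exact absurd this (by positivity)

theorem RegMin.le_of_norm_le (hc : ContDiff ℝ 2 c)
    (h₁ : RegMin (gradV c x) (hessV c x) ⊤ 0 l₁ n₁)
    (h₂ : RegMin (gradV c x) (hessV c x) ⊤ 0 l₂ n₂) (hg : gradV c x ≠ 0) (hn : ‖n₂‖ ≤ ‖n₁‖) :
    l₁ ≤ l₂ := by
  by_contra hlt
  push Not at hlt
  exact absurd (h₂.norm_lt hc h₁ hg hlt) hn.not_gt

theorem RegMin.multiplier_unique (hc : ContDiff ℝ 2 c)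
    (h₁ : RegMin (gradV c x) (hessV c x) ⊤ 0 l₁ n)
    (h₂ : RegMin (gradV c x) (hessV c x) ⊤ 0 l₂ n) (hg : gradV c x ≠ 0) : l₁ = l₂ :=
  le_antisymm (h₁.le_of_norm_le hc h₂ hg le_rfl) (h₂.le_of_norm_le hc h₁ hg le_rfl)

theorem NormalSolution.norm_eq (h : NormalSolution c x r n l) (hl : 0 < l) : ‖n‖ = r := by
  have := (mul_eq_zero.1 h.2.2.2.2.2).resolve_left hl.ne'
  linarith

theorem NormalSolution.decrease_nonneg (h : NormalSolution c x r n l) :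
    0 ≤ modelV c x 0 - modelV c x n :=
  sub_nonneg.2 (h.2.1 0 (by simpa using (norm_nonneg n).trans h.1))

theorem NormalSolution.cauchy_decrease (h : NormalSolution c x r n l) {B τ : ℝ}
    (hB : ‖hessV c x‖ ≤ B) (hτ : 0 ≤ τ) (hτr : τ * ‖gradV c x‖ ≤ r) (hτB : τ * B ≤ 1) :
    1 / 2 * τ * ‖gradV c x‖ ^ 2 ≤ modelV c x 0 - modelV c x n := by
  set g := gradV c x with hgdef
  -- The global minimizer is compared with the steepest descent step of length `τ * ‖g‖`.
  have h1 := h.2.1 ((-τ) • g) (by rwa [norm_smul, norm_neg, Real.norm_of_nonneg hτ])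
  have h2 : inner ℝ g (hessV c x g) ≤ B * ‖g‖ ^ 2 := by
    calc inner ℝ g (hessV c x g) ≤ ‖g‖ * ‖hessV c x g‖ := real_inner_le_norm _ _
      _ ≤ ‖g‖ * (B * ‖g‖) := by
          gcongr
          exact (ContinuousLinearMap.le_opNorm _ _).trans (by gcongr)
      _ = B * ‖g‖ ^ 2 := by ring
  simp only [modelV, ← hgdef, map_smul, inner_smul_left, inner_smul_right, inner_zero_right,
    map_zero, real_inner_self_eq_norm_sq, RCLike.conj_to_real] at h1 ⊢
  have h3 : τ ^ 2 * inner ℝ g (hessV c x g) ≤ τ * ‖g‖ ^ 2 := by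
    calc τ ^ 2 * inner ℝ g (hessV c x g) ≤ τ ^ 2 * (B * ‖g‖ ^ 2) := by gcongr
      _ = (τ * B) * (τ * ‖g‖ ^ 2) := by ring
      _ ≤ 1 * (τ * ‖g‖ ^ 2) := by gcongr
      _ = τ * ‖g‖ ^ 2 := one_mul _
  linarith

variable {f : Vec N → ℝ} {H : Op N} {t : Vec N} {y : Vec M}

theorem SolvesQF.regMin (h : SolvesQF f c x H n l t) :
    RegMin (gradient f x) H (LinearMap.ker (jac c x : Vec N →ₗ[ℝ] Vec M)) n l t :=
  ⟨h.1, fun d hd => h.2 d hd⟩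

theorem TangentialSolution.regMin (hH : IsSelfAdjoint H)
    (h : TangentialSolution f c x H n r t y l) :
    RegMin (gradient f x) H (LinearMap.ker (jac c x : Vec N →ₗ[ℝ] Vec M)) n l t := by
  obtain ⟨h1, -, -, h4, h5, -, -⟩ := h
  refine regMin_of_stationary (fun u w => hH.isSymmetric u w) h1 (fun d hd => ?_)
    fun d hd => h5 d hd
  have hd' : jac c x d = 0 := hd
  have h6 : gradient f x + (H n + l • n) + (H t + l • t) = -(jacT c x y) := by
    rw [eq_neg_iff_add_eq_zero, add_assoc, h4, add_neg_cancel]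
  rw [h6, inner_neg_left, jacT, ContinuousLinearMap.adjoint_inner_left, hd', inner_zero_right,
    neg_zero]

end Subproblems

/-- The common contradiction, applied to `-vmax`, to `-dF` and to the ratio `lamV / ‖n‖`. -/
theorem not_frequently_increment {a : ℕ → ℝ} {k₀ : ℕ} {B δ : ℝ}
    (hmono : ∀ k, k₀ ≤ k → a k ≤ a (k + 1)) (hB : ∀ k, k₀ ≤ k → a k ≤ B) (hδ : 0 < δ)
    (hfreq : ∀ m, ∃ k, m ≤ k ∧ a k + δ ≤ a (k + 1)) : False := by
  have key : ∀ j : ℕ, ∃ k, k₀ ≤ k ∧ a k₀ + j * δ ≤ a k := by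
    intro j
    induction j with
    | zero => exact ⟨k₀, le_rfl, by simp⟩
    | succ j ih =>
      obtain ⟨m, hm, hj⟩ := ih
      obtain ⟨k, hk, hδk⟩ := hfreq m
      have hle : ∀ d, a m ≤ a (m + d) := fun d => by
        induction d with
        | zero => exact le_rfl
        | succ d ih => exact ih.trans (hmono _ (by omega))
      have hmk := hle (k - m)
      rw [Nat.add_sub_cancel' hk] at hmk
      refine ⟨k + 1, by omega, ?_⟩
      push_cast
      linarith
  obtain ⟨j, hj⟩ := exists_nat_gt ((B - a k₀) / δ)
  obtain ⟨k, hk, hjk⟩ := key j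
  rw [div_lt_iff₀ hδ] at hj
  linarith [hB k hk]

/-! ### Consequences of a single iteration. -/

section Steps

variable {N M : ℕ} {p : Params} {f : Vec N → ℝ} {c : Vec N → Vec M} {R : Trace N} {k : ℕ}

theorem ComputeSteps.exists_tangential (h : ComputeSteps p f c R k) (ht : R.t k ≠ 0) :
    ‖R.n k‖ ≤ p.kn * R.dS p k ∧ KeepTangential p c (R.x k) (R.n k) (R.t k) ∧
      ∃ y, TangentialSolution f c (R.x k) (R.H k) (R.n k) (R.dS p k) (R.t k) y (R.lamF k) := by
  obtain ⟨-, h1, h2⟩ := h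
  by_cases hcond : ‖R.n k‖ ≤ p.kn * R.dS p k ∧
      p.kp * ‖gradV c (R.x k)‖ ≤ ‖projGrad f c (R.x k) (R.H k) (R.n k)‖
  · obtain ⟨t, y, lam, hsol, hk, hnk⟩ := h1 hcond
    by_cases hkeep : KeepTangential p c (R.x k) (R.n k) t
    · obtain ⟨rfl, rfl⟩ := hk hkeep
      exact ⟨hcond.1, hkeep, y, hsol⟩
    · exact absurd (hnk hkeep).1 ht
  · exact absurd (h2 hcond).1 ht

theorem ComputeSteps.mul_norm_le_norm_s (h : ComputeSteps p f c R k) :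
    p.ktn * ‖R.n k‖ ≤ ‖R.s k‖ := by
  by_cases ht : R.t k = 0
  · rw [Trace.s, ht, add_zero]
    exact mul_le_of_le_one_left (norm_nonneg _) p.ktn_mem.2.le
  · exact (h.exists_tangential ht).2.1.2.1

theorem ComputeSteps.norm_s_le (h : ComputeSteps p f c R k) : ‖R.s k‖ ≤ p.kdelta * R.dV k := by
  by_cases ht : R.t k = 0
  · rw [Trace.s, ht, add_zero]
    have h1 := h.1.1
    exact h1.trans (le_mul_of_one_le_left ((norm_nonneg _).trans h1) p.one_lt_kdelta.le)
  · obtain ⟨-, -, y, hy⟩ := h.exists_tangential ht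
    exact hy.2.1.trans (min_le_left _ _)

theorem ComputeSteps.model_decrease (h : ComputeSteps p f c R k) :
    p.kvm * (modelV c (R.x k) 0 - modelV c (R.x k) (R.n k)) ≤
      modelV c (R.x k) 0 - modelV c (R.x k) (R.s k) := by
  by_cases ht : R.t k = 0
  · rw [Trace.s, ht, add_zero]
    exact mul_le_of_le_one_left h.1.decrease_nonneg p.kvm_mem.2.le
  · exact (h.exists_tangential ht).2.1.1

/-- Merges the two ways of choosing the parameter when `lamV` is small. The upper bound on `l` later
keeps the new radius from collapsing; the lower bound starts the growth of the ratio. -/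
theorem VContract.cases (hc : ContDiff ℝ 2 c)
    (hN : NormalSolution c (R.x k) (R.dV k) (R.n k) (R.lamV k)) (hg : gradV c (R.x k) ≠ 0)
    (h : VContract p c R k) :
    (R.lamV k < p.sigMin * ‖R.n k‖ ∧ ∃ l n, R.lamV k < l ∧
        l ≤ R.lamV k + Real.sqrt (p.sigMin * ‖gradV c (R.x k)‖) ∧
        SolvesQV c (R.x k) l n ∧ p.sigMin * ‖n‖ ≤ l ∧ R.dV (k + 1) = ‖n‖) ∨
      (p.sigMin * ‖R.n k‖ ≤ R.lamV k ∧ p.gc * ‖R.n k‖ ≤ R.dV (k + 1) ∧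
        ((∃ n, SolvesQV c (R.x k) (p.glam * R.lamV k) n ∧ R.dV (k + 1) = ‖n‖) ∨
          R.dV (k + 1) = p.gc * ‖R.n k‖)) := by
  rcases lt_or_ge (R.lamV k) (p.sigMin * ‖R.n k‖) with hl | hl
  · refine Or.inl ⟨hl, ?_⟩
    obtain ⟨l, n, hle, hsol, h1, h2⟩ := h.1 hl
    set w := Real.sqrt (p.sigMin * ‖gradV c (R.x k)‖) with hw
    have hgpos : 0 < ‖gradV c (R.x k)‖ := norm_pos_iff.2 hg
    have hwpos : 0 < w := Real.sqrt_pos.2 (mul_pos p.sigMin_pos hgpos)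
    have hw2 : w * w = p.sigMin * ‖gradV c (R.x k)‖ :=
      Real.mul_self_sqrt (mul_pos p.sigMin_pos hgpos).le
    have hl0 : 0 ≤ R.lamV k := hN.2.2.2.2.1
    have hnpos : 0 < ‖n‖ := hsol.regMin.norm_pos hc hg
    by_cases hs : l / ‖n‖ ≤ p.sigMax
    · refine ⟨l, n, by linarith, hle.le, hsol, ?_, h1 hs⟩
      -- Semidefiniteness at `lamV` and stationarity at `lamV + w` give `w * ‖n‖ ≤ ‖gradV‖`. Since
      -- `w * w = sigMin * ‖gradV‖`, it follows that `sigMin * ‖n‖ ≤ w ≤ l`.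
      have e1 := hN.2.2.2.1 n
      have e2 : inner ℝ n (gradV c (R.x k) + (hessV c (R.x k) n + l • n)) = 0 := by
        rw [hsol.regMin.normal_eq hc, inner_zero_right]
      have e3 : -(inner ℝ n (gradV c (R.x k))) ≤ ‖n‖ * ‖gradV c (R.x k)‖ :=
        (neg_le_abs _).trans (abs_real_inner_le_norm _ _)
      rw [hle] at e2
      simp only [inner_add_right, inner_smul_right, real_inner_self_eq_norm_sq] at e1 e2
      have e4 : ‖n‖ * (w * ‖n‖) ≤ ‖n‖ * ‖gradV c (R.x k)‖ := by linarith
      have e5 : w * ‖n‖ ≤ ‖gradV c (R.x k)‖ := le_of_mul_le_mul_left e4 hnpos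
      have e6 : w * (p.sigMin * ‖n‖) ≤ w * w := by
        rw [hw2]
        calc w * (p.sigMin * ‖n‖) = p.sigMin * (w * ‖n‖) := by ring
          _ ≤ p.sigMin * ‖gradV c (R.x k)‖ := mul_le_mul_of_nonneg_left e5 p.sigMin_pos.le
      have e7 := le_of_mul_le_mul_left e6 hwpos
      linarith
    · obtain ⟨l', n', h3, h4, h5, h6, -, h7⟩ := h2 (not_le.1 hs)
      have hn' : 0 < ‖n'‖ := h5.regMin.norm_pos hc hg
      exact ⟨l', n', h3, h4.le.trans hle.le, h5, (le_div_iff₀ hn').1 h6, h7⟩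
  · refine Or.inr ⟨hl, ?_⟩
    obtain ⟨n, h1, h2, h3⟩ := h.2 hl
    rcases le_or_gt (p.gc * ‖R.n k‖) ‖n‖ with hn | hn
    · exact ⟨hn.trans_eq (h2 hn).symm, Or.inl ⟨n, h1, h2 hn⟩⟩
    · exact ⟨(h3 hn).ge, Or.inr (h3 hn)⟩

theorem VContract.radius_mem (hc : ContDiff ℝ 2 c)
    (hN : NormalSolution c (R.x k) (R.dV k) (R.n k) (R.lamV k)) (hg : gradV c (R.x k) ≠ 0)
    (h : VContract p c R k) : 0 < R.dV (k + 1) ∧ R.dV (k + 1) ≤ ‖R.n k‖ := by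
  have hnpos := (hN.regMin hc).norm_pos hc hg
  rcases h.cases hc hN hg with ⟨-, l, n, h1, -, h2, -, h3⟩ | ⟨h1, -, ⟨n, h2, h3⟩ | h3⟩
  · rw [h3]
    exact ⟨h2.regMin.norm_pos hc hg, ((hN.regMin hc).norm_lt hc h2.regMin hg h1).le⟩
  · rw [h3]
    have hl : 0 < R.lamV k := (mul_pos p.sigMin_pos hnpos).trans_le h1
    exact ⟨h2.regMin.norm_pos hc hg, ((hN.regMin hc).norm_lt hc h2.regMin hg
      (by nlinarith [p.one_lt_glam])).le⟩
  · rw [h3]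
    exact ⟨mul_pos p.gc_mem.1 hnpos, mul_le_of_le_one_left hnpos.le p.gc_mem.2.le⟩

/-- The step of iteration `k` is taken. -/
def Accepted (p : Params) (f : Vec N → ℝ) (c : Vec N → Vec M) (R : Trace N) (k : ℕ) : Prop :=
  (IsFIteration p f c R k ∧ p.krho ≤ rhoF f R k) ∨ (¬ IsFIteration p f c R k ∧ VAccept p c R k)

theorem rhoV_decrease (hs : 0 < ‖R.s k‖) (h : p.krho ≤ rhoV c R k) :
    infeas c (R.x k + R.s k) ≤ infeas c (R.x k) - p.krho * ‖R.s k‖ ^ 3 := by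
  rw [rhoV, le_div_iff₀ (by positivity)] at h
  linarith

end Steps

/-! ### An infinite run: bounds on radii, normal steps and multipliers; finitely many acceptances.
-/

section Run

variable {N M : ℕ} {p : Params} {f : Vec N → ℝ} {c : Vec N → Vec M} {R : Trace N}

theorem gradV_ne_zero {k : ℕ} (hk : k ∈ activeSet p c R) : gradV c (R.x k) ≠ 0 :=
  norm_pos_iff.1 (p.eps_pos.trans hk)

theorem IsRun.norm_n_pos (hR : IsRun p f c R) (hc : ContDiff ℝ 2 c) {k : ℕ}
    (hk : k ∈ activeSet p c R) : 0 < ‖R.n k‖ :=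
  ((hR.steps k hk).1.regMin hc).norm_pos hc (gradV_ne_zero hk)

theorem IsRun.norm_s_pos (hR : IsRun p f c R) (hc : ContDiff ℝ 2 c) {k : ℕ}
    (hk : k ∈ activeSet p c R) : 0 < ‖R.s k‖ :=
  (mul_pos p.ktn_mem.1 (hR.norm_n_pos hc hk)).trans_le (hR.steps k hk).mul_norm_le_norm_s

theorem IsRun.sig_le_succ (hR : IsRun p f c R) {k : ℕ} (hk : k + 1 ∈ activeSet p c R) :
    R.sig k ≤ R.sig (k + 1) := by
  have h := hR.sigma k hk
  by_cases hF : IsFIteration p f c R k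
  · exact (h.1 hF).ge
  · rcases lt_or_ge (rhoV c R k) p.krho with hr | hr
    · exact (le_max_left _ _).trans_eq ((h.2 hF).1 hr).symm
    · exact ((h.2 hF).2 hr).ge

theorem IsRun.sigMin_le_sig (hR : IsRun p f c R) (hact : ∀ k, k ∈ activeSet p c R) (k : ℕ) :
    p.sigMin ≤ R.sig k := by
  induction k with
  | zero => exact hR.sig_init.1
  | succ k ih => exact ih.trans (hR.sig_le_succ (hact _))

theorem IsRun.radius_mem (hR : IsRun p f c R) (hc : ContDiff ℝ 2 c)
    (hact : ∀ k, k ∈ activeSet p c R) (k : ℕ) : 0 < R.dV k ∧ R.dV k ≤ R.dMaxV k := by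
  induction k with
  | zero => exact ⟨hR.dV_init, hR.dV_le_init⟩
  | succ k ih =>
    have hN := (hR.steps k (hact k)).1
    by_cases hF : IsFIteration p f c R k
    · have h := hR.fIteration k (hact k) hF
      rwa [h.1, h.2.1]
    · obtain ⟨-, h1, h2, h3⟩ := hR.vIteration k (hact k) hF
      by_cases hA : VAccept p c R k
      · obtain ⟨-, -, h4, h5⟩ := h1 hA
        rw [h5]
        refine ⟨lt_min ?_ (lt_max_of_lt_left ih.1), min_le_left _ _⟩
        rw [h4]
        exact lt_max_of_lt_left (ih.1.trans_le ih.2)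
      · rcases lt_or_ge (rhoV c R k) p.krho with hr | hr
        · obtain ⟨-, -, h4, h5⟩ := h2 hr
          have h6 := h5.radius_mem hc hN (gradV_ne_zero (hact k))
          exact ⟨h6.1, by rw [h4]; exact h6.2.trans (hN.1.trans ih.2)⟩
        · obtain ⟨-, -, h4, h5⟩ := h3 hA hr
          rw [h5]
          refine ⟨lt_min ?_ ?_, min_le_left _ _⟩
          · rw [h4]
            exact ih.1.trans_le ih.2
          · have hsig := p.sigMin_pos.trans_le (hR.sigMin_le_sig hact k)
            have hl : R.sig k * ‖R.n k‖ < R.lamV k := by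
              by_contra hle
              exact hA ⟨hr, Or.inl (not_lt.1 hle)⟩
            exact div_pos ((mul_nonneg hsig.le (norm_nonneg _)).trans_lt hl) hsig

/-- An iteration that neither takes its step nor contracts the radius expands it. -/
theorem IsRun.expand (hR : IsRun p f c R) (hc : ContDiff ℝ 2 c)
    (hact : ∀ k, k ∈ activeSet p c R) {k : ℕ} (hF : ¬ IsFIteration p f c R k)
    (hA : ¬ VAccept p c R k) (hr : p.krho ≤ rhoV c R k) :
    R.sig k * ‖R.n k‖ < R.lamV k ∧ R.dV k = ‖R.n k‖ ∧ R.dV k ≤ R.dV (k + 1) ∧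
      R.x (k + 1) = R.x k ∧ R.dV (k + 1) = min (R.dMaxV (k + 1)) (R.lamV k / R.sig k) := by
  have hN := (hR.steps k (hact k)).1
  obtain ⟨h1, -, h4, h5⟩ := (hR.vIteration k (hact k) hF).2.2.2 hA hr
  have hsig := p.sigMin_pos.trans_le (hR.sigMin_le_sig hact k)
  have hl : R.sig k * ‖R.n k‖ < R.lamV k := by
    by_contra hle
    exact hA ⟨hr, Or.inl (not_lt.1 hle)⟩
  have hn := hN.norm_eq ((mul_nonneg hsig.le (norm_nonneg _)).trans_lt hl)
  refine ⟨hl, hn.symm, ?_, h1, h5⟩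
  rw [h5, h4]
  refine le_min (hR.radius_mem hc hact k).2 ?_
  rw [le_div_iff₀ hsig, mul_comm, ← hn]
  exact hl.le

theorem IsRun.exists_step_bound (hR : IsRun p f c R)
    (hact : ∀ k, k ∈ activeSet p c R) (hx : ∃ K : Set (Vec N), IsCompact K ∧ ∀ k, R.x k ∈ K) :
    ∃ D : ℝ, ∀ k, R.dMaxV k ≤ D := by
  obtain ⟨K, hK, hxK⟩ := hx
  obtain ⟨r, hr⟩ := hK.isBounded.exists_norm_le
  -- `dMaxV` grows only when a V-step is accepted; then `s` joins two iterates of norm at most `r`,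
  -- and `ktn * ‖n‖ ≤ ‖s‖`.
  refine ⟨max (R.dMaxV 0) (p.ge * ((r + r) / p.ktn)), fun k => ?_⟩
  induction k with
  | zero => exact le_max_left _ _
  | succ k ih =>
    by_cases hF : IsFIteration p f c R k
    · rwa [(hR.fIteration k (hact k) hF).2.1]
    · obtain ⟨-, h1, h2, h3⟩ := hR.vIteration k (hact k) hF
      by_cases hA : VAccept p c R k
      · obtain ⟨hx1, -, h4, -⟩ := h1 hA
        rw [h4]
        refine max_le ih ((mul_le_mul_of_nonneg_left ?_ (zero_lt_one.trans p.one_lt_ge).le).trans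
          (le_max_right _ _))
        rw [le_div_iff₀ p.ktn_mem.1, mul_comm]
        refine (hR.steps k (hact k)).mul_norm_le_norm_s.trans ?_
        rw [← sub_eq_iff_eq_add'.2 hx1]
        exact (norm_sub_le _ _).trans (add_le_add (hr _ (hxK _)) (hr _ (hxK _)))
      · rcases lt_or_ge (rhoV c R k) p.krho with hr | hr
        · rwa [(h2 hr).2.2.1]
        · rwa [(h3 hA hr).2.2.1]

theorem IsRun.exists_radius_threshold (hR : IsRun p f c R) (hc : ContDiff ℝ 2 c)
    (hact : ∀ k, k ∈ activeSet p c R) (hx : ∃ K : Set (Vec N), IsCompact K ∧ ∀ k, R.x k ∈ K)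
    {B : ℝ} (hB0 : 0 ≤ B) (hB : ∀ k, ‖hessV c (R.x k)‖ ≤ B) :
    ∃ r : ℝ, 0 < r ∧ ∀ k, R.dV k ≤ r → p.krho ≤ rhoV c R k := by
  obtain ⟨D, hD⟩ := hR.exists_step_bound hact hx
  obtain ⟨K, hK, hxK⟩ := hx
  obtain ⟨C, hC0, hC⟩ := exists_infeas_le_model hc hK (p.kdelta * D)
  have heps := p.eps_pos
  have hkd : 0 < p.kdelta := zero_lt_one.trans p.one_lt_kdelta
  have hkvm := p.kvm_mem.1
  set Q := C * p.kdelta ^ 2 + p.kdelta ^ 3 with hQ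
  have hQpos : 0 < Q := by positivity
  -- The bound 1 lets the cubic term be absorbed into a quadratic one, the second makes the Cauchy
  -- step of length `dV` admissible, and the third makes the total error `Q * dV ^ 2` at most the
  -- guaranteed decrease.
  refine ⟨min 1 (min (p.eps / (1 + B)) (1 / 2 * p.kvm * p.eps / Q)), by positivity,
    fun k hk => ?_⟩
  have hstep := hR.steps k (hact k)
  have hd := hR.radius_mem hc hact k
  have hk1 := hk.trans (min_le_left _ _)
  have hk2 := hk.trans ((min_le_right _ _).trans (min_le_left _ _))
  have hk3 := hk.trans ((min_le_right _ _).trans (min_le_right _ _))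
  rw [le_div_iff₀ (by positivity)] at hk2 hk3
  have hgk : p.eps < ‖gradV c (R.x k)‖ := hact k
  have hgpos := heps.trans hgk
  have h1 := hstep.1.cauchy_decrease (hB k) (τ := R.dV k / ‖gradV c (R.x k)‖)
    (div_nonneg hd.1.le hgpos.le) (by rw [div_mul_cancel₀ _ hgpos.ne'])
    (by rw [div_mul_eq_mul_div, div_le_one hgpos]; nlinarith [hd.1])
  have h2 : 1 / 2 * (R.dV k / ‖gradV c (R.x k)‖) * ‖gradV c (R.x k)‖ ^ 2 =
      1 / 2 * R.dV k * ‖gradV c (R.x k)‖ := by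
    field_simp
  rw [h2] at h1
  have h3 : 1 / 2 * R.dV k * p.eps ≤ modelV c (R.x k) 0 - modelV c (R.x k) (R.n k) := by
    refine le_trans ?_ h1
    have := hd.1
    gcongr
  have h4 := (mul_le_mul_of_nonneg_left h3 hkvm.le).trans hstep.model_decrease
  have hs := hstep.norm_s_le
  have h5 := hC (R.x k) (hxK k) (R.s k)
    (hs.trans (mul_le_mul_of_nonneg_left (hd.2.trans (hD k)) hkd.le))
  have h6 : modelV c (R.x k) 0 = infeas c (R.x k) := by simp [modelV]
  have h7 : C * ‖R.s k‖ ^ 2 ≤ C * (p.kdelta * R.dV k) ^ 2 := by gcongr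
  have h8 : ‖R.s k‖ ^ 3 ≤ (p.kdelta * R.dV k) ^ 3 := by gcongr
  have h9 : (p.kdelta * R.dV k) ^ 3 ≤ p.kdelta ^ 3 * R.dV k ^ 2 := by
    rw [mul_pow]
    exact mul_le_mul_of_nonneg_left (pow_le_pow_of_le_one hd.1.le hk1 (by norm_num))
      (by positivity)
  have h10 : R.dV k * (R.dV k * Q) ≤ R.dV k * (1 / 2 * p.kvm * p.eps) :=
    mul_le_mul_of_nonneg_left hk3 hd.1.le
  have hspos := hR.norm_s_pos hc (hact k)
  rw [rhoV, le_div_iff₀ (by positivity)]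
  have h11 : p.krho * ‖R.s k‖ ^ 3 ≤ ‖R.s k‖ ^ 3 :=
    mul_le_of_le_one_left (by positivity) p.krho_mem.2.le
  rw [hQ] at h10
  linarith

theorem IsRun.exists_radius_lower_bound (hR : IsRun p f c R) (hc : ContDiff ℝ 2 c)
    (hact : ∀ k, k ∈ activeSet p c R) (hx : ∃ K : Set (Vec N), IsCompact K ∧ ∀ k, R.x k ∈ K)
    {B G : ℝ} (hB0 : 0 ≤ B) (hB : ∀ k, ‖hessV c (R.x k)‖ ≤ B)
    (hG : ∀ k, ‖gradV c (R.x k)‖ ≤ G) :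
    ∃ r : ℝ, 0 < r ∧ ∀ k, r ≤ R.dV k := by
  obtain ⟨r, hr0, hr⟩ := hR.exists_radius_threshold hc hact hx hB0 hB
  obtain ⟨D, hD⟩ := hR.exists_step_bound hact hx
  have hD0 : 0 < D := ((hR.radius_mem hc hact 0).1.trans_le
    (hR.radius_mem hc hact 0).2).trans_le (hD 0)
  have heps := p.eps_pos
  have hgc := p.gc_mem.1
  have hsm := p.sigMin_pos
  set L := p.sigMin * D + Real.sqrt (p.sigMin * G) with hL
  have hL0 : 0 < L := by positivity
  have hd0 := hR.dV_init
  -- Only contraction can reduce `dV`. With a large multiplier, `‖n‖ = dV > r` and at most a factor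
  -- `gc` is lost; with a small one, the new step has parameter at most `L`, and `eps < (B + L) *
  -- ‖n‖`.
  refine ⟨min (R.dV 0) (min (p.gc * r) (p.eps / (B + L))), by positivity, fun k => ?_⟩
  induction k with
  | zero => exact min_le_left _ _
  | succ k ih =>
    have hN := (hR.steps k (hact k)).1
    by_cases hF : IsFIteration p f c R k
    · rwa [(hR.fIteration k (hact k) hF).1]
    · obtain ⟨-, h1, h2, h3⟩ := hR.vIteration k (hact k) hF
      by_cases hA : VAccept p c R k
      · obtain ⟨-, -, h4, h5⟩ := h1 hA
        refine ih.trans ?_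
        rw [h5, h4]
        exact le_min ((hR.radius_mem hc hact k).2.trans (le_max_left _ _)) (le_max_left _ _)
      · rcases lt_or_ge (rhoV c R k) p.krho with hrk | hrk
        · obtain ⟨-, -, h4, h5⟩ := h2 hrk
          have hg := gradV_ne_zero (hact k)
          rcases h5.cases hc hN hg with ⟨h6, l, n, h7, h8, h9, -, h10⟩ | ⟨h6, h7, -⟩
          · rw [h10]
            refine (min_le_right _ _).trans ((min_le_right _ _).trans ?_)
            have hlL : l ≤ L := by
              refine h8.trans (add_le_add ?_ (Real.sqrt_le_sqrt ?_))
              · exact h6.le.trans (mul_le_mul_of_nonneg_left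
                  (hN.1.trans ((hR.radius_mem hc hact k).2.trans (hD k))) hsm.le)
              · exact mul_le_mul_of_nonneg_left (hG k) hsm.le
            have hgk : p.eps < ‖gradV c (R.x k)‖ := hact k
            rw [div_le_iff₀ (by positivity), mul_comm]
            refine hgk.le.trans ((h9.regMin.norm_gradV_le hc (hB k)
              (hN.2.2.2.2.1.trans h7.le)).trans ?_)
            gcongr
          · refine (min_le_right _ _).trans ((min_le_left _ _).trans (le_trans ?_ h7))
            have hn := hN.norm_eq ((mul_pos hsm (hR.norm_n_pos hc (hact k))).trans_le h6)
            rw [hn]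
            refine mul_le_mul_of_nonneg_left ?_ hgc.le
            by_contra hlt
            exact hrk.not_ge (hr k (not_le.1 hlt).le)
        · exact ih.trans (hR.expand hc hact hF hA hrk).2.2.1

theorem IsRun.exists_normal_bounds (hR : IsRun p f c R) (hc : ContDiff ℝ 2 c)
    (hact : ∀ k, k ∈ activeSet p c R) (hx : ∃ K : Set (Vec N), IsCompact K ∧ ∀ k, R.x k ∈ K) :
    ∃ r L : ℝ, 0 < r ∧ ∀ k, r ≤ ‖R.n k‖ ∧ R.lamV k ≤ L := by
  have hx' := hx
  obtain ⟨K, hK, hxK⟩ := hx'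
  obtain ⟨B, hB⟩ := hK.exists_bound_of_continuousOn (continuous_hessV hc).continuousOn
  obtain ⟨G, hG⟩ := hK.exists_bound_of_continuousOn (continuous_gradV hc).continuousOn
  have hB0 : 0 ≤ B := (norm_nonneg _).trans (hB _ (hxK 0))
  have hG0 : 0 ≤ G := (norm_nonneg _).trans (hG _ (hxK 0))
  obtain ⟨r, hr0, hr⟩ := hR.exists_radius_lower_bound hc hact hx hB0 (fun k => hB _ (hxK k))
    fun k => hG _ (hxK k)
  have heps := p.eps_pos
  have hlow : ∀ k, min r (p.eps / (B + 1)) ≤ ‖R.n k‖ := by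
    intro k
    have hN := (hR.steps k (hact k)).1
    rcases hN.2.2.2.2.1.eq_or_lt with h0 | hpos
    · refine (min_le_right _ _).trans ?_
      have hgk : p.eps < ‖gradV c (R.x k)‖ := hact k
      have h1 := (hN.regMin hc).norm_gradV_le hc (hB _ (hxK k)) h0.le
      rw [div_le_iff₀ (by positivity)]
      rw [← h0] at h1
      linarith [norm_nonneg (R.n k)]
    · rw [hN.norm_eq hpos]
      exact (min_le_left _ _).trans (hr k)
  have hpos : 0 < min r (p.eps / (B + 1)) := by positivity
  refine ⟨_, G / min r (p.eps / (B + 1)) + B, hpos, fun k => ⟨hlow k, ?_⟩⟩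
  have hN := (hR.steps k (hact k)).1
  have h1 := (hN.regMin hc).mul_norm_le hc (hB _ (hxK k)) hN.2.2.2.2.1
  have hn := hR.norm_n_pos hc (hact k)
  have h2 : R.lamV k ≤ ‖gradV c (R.x k)‖ / ‖R.n k‖ + B := by
    rw [← sub_le_iff_le_add, le_div_iff₀ hn]
    linarith
  refine h2.trans (add_le_add_left ?_ _)
  exact div_le_div₀ hG0 (hG _ (hxK k)) hpos (hlow k)

/-- Both types of accepted step give `v (k + 1) ≤ vmax k - krho * ‖s‖ ^ 3`: by the funnel test, or
by the ratio test and `v ≤ vmax`. The second term of the update minimum turns a fraction `1 - kv2`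
of that gap into a decrease of `vmax`. -/
theorem IsRun.vmax_step (hR : IsRun p f c R) (hc : ContDiff ℝ 2 c) {k : ℕ}
    (hk : k ∈ activeSet p c R) (hv : infeas c (R.x k) ≤ R.vmax k) :
    infeas c (R.x (k + 1)) ≤ R.vmax (k + 1) ∧
      ((Accepted p f c R k ∧
          (1 - p.kv2) * (p.krho * ‖R.s k‖ ^ 3) ≤ R.vmax k - R.vmax (k + 1)) ∨
        (¬ Accepted p f c R k ∧ R.x (k + 1) = R.x k ∧ R.vmax (k + 1) = R.vmax k)) := by
  have hs := hR.norm_s_pos hc hk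
  have hkr := p.krho_mem.1
  obtain ⟨hk20, hk21⟩ := p.kv2_mem
  have hdec : 0 ≤ p.krho * ‖R.s k‖ ^ 3 := by positivity
  by_cases hF : IsFIteration p f c R k
  · obtain ⟨-, -, h1, h2⟩ := hR.fIteration k hk hF
    rcases le_or_gt p.krho (rhoF f R k) with hr | hr
    · obtain ⟨hx1, hvm, -⟩ := h1 hr
      have h3 : infeas c (R.x (k + 1)) ≤ R.vmax k - p.krho * ‖R.s k‖ ^ 3 := by
        rw [hx1]
        exact hF.2.2.2.1
      refine ⟨?_, Or.inl ⟨Or.inl ⟨hF, hr⟩, ?_⟩⟩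
      · rw [hvm]
        refine le_min (h3.trans (le_max_right _ _)) ?_
        exact le_add_of_nonneg_right (mul_nonneg hk20.le (by linarith))
      · have h4 := hvm.le.trans (min_le_right _ _)
        nlinarith
    · obtain ⟨hx1, hvm, -⟩ := h2 hr
      refine ⟨by rwa [hx1, hvm], Or.inr ⟨?_, hx1, hvm⟩⟩
      rintro (h | h)
      · exact hr.not_ge h.2
      · exact h.1 hF
  · obtain ⟨-, h1, h2, h3⟩ := hR.vIteration k hk hF
    by_cases hA : VAccept p c R k
    · obtain ⟨hx1, hvm, -, -⟩ := h1 hA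
      have h4 : infeas c (R.x (k + 1)) ≤ infeas c (R.x k) - p.krho * ‖R.s k‖ ^ 3 := by
        rw [hx1]
        exact rhoV_decrease hs hA.1
      refine ⟨?_, Or.inl ⟨Or.inr ⟨hF, hA⟩, ?_⟩⟩
      · rw [hvm]
        refine le_min (le_max_of_le_right ?_) ?_
        · exact le_add_of_nonneg_right (mul_nonneg hk20.le (by linarith))
        · exact le_add_of_nonneg_right (mul_nonneg hk20.le (by linarith))
      · have h5 := hvm.le.trans (min_le_right _ _)
        nlinarith
    · have hnot : ¬ Accepted p f c R k := by
        rintro (h | h)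
        · exact hF h.1
        · exact hA h.2
      rcases lt_or_ge (rhoV c R k) p.krho with hr | hr
      · obtain ⟨hx1, hvm, -⟩ := h2 hr
        exact ⟨by rwa [hx1, hvm], Or.inr ⟨hnot, hx1, hvm⟩⟩
      · obtain ⟨hx1, hvm, -⟩ := h3 hA hr
        exact ⟨by rwa [hx1, hvm], Or.inr ⟨hnot, hx1, hvm⟩⟩

theorem IsRun.eventually_not_accepted (hR : IsRun p f c R) (hc : ContDiff ℝ 2 c)
    (hact : ∀ k, k ∈ activeSet p c R) {r : ℝ} (hr0 : 0 < r) (hr : ∀ k, r ≤ ‖R.n k‖) :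
    ∃ k₀, ∀ k, k₀ ≤ k → ¬ Accepted p f c R k := by
  have hv : ∀ k, infeas c (R.x k) ≤ R.vmax k := by
    intro k
    induction k with
    | zero => exact (le_max_right _ _).trans hR.vmax_init
    | succ k ih => exact (hR.vmax_step hc (hact k) ih).1
  have hkr := p.krho_mem.1
  have hkt := p.ktn_mem.1
  have hk2 : 0 < 1 - p.kv2 := sub_pos.2 p.kv2_mem.2
  by_contra! hcon
  refine not_frequently_increment (a := fun k => -R.vmax k) (k₀ := 0) (B := 0)
    (δ := (1 - p.kv2) * (p.krho * (p.ktn * r) ^ 3)) (fun k _ => ?_) (fun k _ => ?_)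
    (by positivity) fun m => ?_
  · rcases (hR.vmax_step hc (hact k) (hv k)).2 with h | h
    · have : 0 ≤ (1 - p.kv2) * (p.krho * ‖R.s k‖ ^ 3) := by positivity
      linarith [h.2]
    · exact (neg_le_neg h.2.2.le)
  · have : 0 ≤ infeas c (R.x k) := by unfold infeas; positivity
    linarith [hv k]
  · obtain ⟨k, hk, hA⟩ := hcon m
    refine ⟨k, hk, ?_⟩
    rcases (hR.vmax_step hc (hact k) (hv k)).2 with h | h
    · have h1 : p.ktn * r ≤ ‖R.s k‖ :=
        (mul_le_mul_of_nonneg_left (hr k) hkt.le).trans (hR.steps k (hact k)).mul_norm_le_norm_s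
      have h2 : (1 - p.kv2) * (p.krho * (p.ktn * r) ^ 3) ≤
          (1 - p.kv2) * (p.krho * ‖R.s k‖ ^ 3) := by gcongr
      linarith [h.2]
    · exact absurd hA h.1

end Run

/-! ### The tail of rejected steps. -/

section Tail

variable {N M : ℕ} {p : Params} {f : Vec N → ℝ} {c : Vec N → Vec M} {R : Trace N}

theorem IsRun.tangential (hR : IsRun p f c R) {k : ℕ} (hk : k ∈ activeSet p c R)
    (hF : IsFIteration p f c R k) :
    ‖R.n k‖ ≤ p.kn * R.dF k ∧ ‖R.s k‖ ≤ R.dF k ∧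
      RegMin (gradient f (R.x k)) (R.H k) (LinearMap.ker (jac c (R.x k) : Vec N →ₗ[ℝ] Vec M))
        (R.n k) (R.lamF k) (R.t k) := by
  obtain ⟨h1, -, y, hy⟩ := (hR.steps k hk).exists_tangential hF.1
  exact ⟨h1.trans (mul_le_mul_of_nonneg_left (min_le_right _ _) p.kn_mem.1.le),
    hy.2.1.trans (min_le_right _ _), hy.regMin (hR.symm k hk)⟩

theorem IsRun.radius_le_of_rejected (hR : IsRun p f c R) {k : ℕ} (hk : k ∈ activeSet p c R)
    (hF : RejectedFIteration p f c R k) : R.dF (k + 1) ≤ ‖R.s k‖ := by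
  obtain ⟨-, -, h3⟩ := (hR.fIteration k hk hF.1).2.2.2 hF.2
  rcases lt_or_ge (R.lamF k) (p.sigMin * ‖R.s k‖) with hl | hl
  · obtain ⟨lam, t, h4, h5, -, h6⟩ := h3.1 hl
    rw [h6]
    exact (hR.tangential hk hF.1).2.2.norm_le h5.regMin h4
  · rw [h3.2 hl]
    exact mul_le_of_le_one_left (norm_nonneg _) p.gc_mem.2.le

/-- The contraction parameter has ratio at least `sigMin` and the next problem is the same with a
smaller radius, so its multiplier should be no smaller. The test on `inner (n k) (t k)` rules out
the degenerate case. -/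
theorem IsRun.multiplier_of_rejected (hR : IsRun p f c R) {k : ℕ} (hk : k ∈ activeSet p c R)
    (hk' : k + 1 ∈ activeSet p c R) (hF : RejectedFIteration p f c R k)
    (hkeep : R.H (k + 1) = R.H k ∧ R.n (k + 1) = R.n k) (hF' : IsFIteration p f c R (k + 1))
    (hl : R.lamF k < p.sigMin * ‖R.s k‖) : p.sigMin * ‖R.s (k + 1)‖ ≤ R.lamF (k + 1) := by
  obtain ⟨hx, -, h3⟩ := (hR.fIteration k hk hF.1).2.2.2 hF.2
  obtain ⟨lam, t, -, h5, h7, h6⟩ := h3.1 hl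
  obtain ⟨-, hs, hmin⟩ := hR.tangential hk' hF'
  rw [h6] at hs
  have hsm := p.sigMin_pos
  have hpos : 0 < ‖R.n k + t‖ := by
    refine (norm_nonneg _).lt_of_ne fun h0 => ?_
    rw [← h0, div_zero] at h7
    exact h7.not_gt hsm
  rw [le_div_iff₀ hpos] at h7
  refine (mul_le_mul_of_nonneg_left hs hsm.le).trans (h7.trans ?_)
  by_contra hlt
  push Not at hlt
  have hH := hR.symm _ hk'
  have hntt := hF'.2.2.2.2.1
  rw [Trace.s, hkeep.2] at hs
  rw [hkeep.1] at hH
  rw [hkeep.1, hkeep.2, hx] at hmin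
  rw [hkeep.2] at hntt
  -- Orthogonality of `n + t` to `t` means that the inner product of `n` and `t` is `-‖t‖ ^ 2`,
  -- below the allowed `-(1 / 2) * kntt * ‖t‖ ^ 2`.
  have ho := hmin.orthogonal_of_norm_le (fun u w => hH.isSymmetric u w) h5.regMin hlt hs hmin.1
  rw [inner_add_left, real_inner_self_eq_norm_sq] at ho
  have ht : 0 < ‖R.t (k + 1)‖ ^ 2 := by
    have := norm_pos_iff.2 hF'.1
    positivity
  nlinarith [p.kntt_mem.2]

theorem IsRun.exists_not_rejected (hR : IsRun p f c R)
    (hact : ∀ k, k ∈ activeSet p c R)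
    (hkeep : ∀ k ∈ activeSet p c R, RejectedFIteration p f c R k →
      R.H (k + 1) = R.H k ∧ R.n (k + 1) = R.n k)
    {r : ℝ} (hr0 : 0 < r) (hr : ∀ k, r ≤ ‖R.n k‖) (k₀ : ℕ) :
    ∃ k, k₀ ≤ k ∧ ¬ RejectedFIteration p f c R k := by
  by_contra! hrej
  obtain ⟨hgc0, hgc1⟩ := p.gc_mem
  have hkn := p.kn_mem.1
  have hlow : ∀ k, k₀ ≤ k → r / p.kn ≤ R.dF k := fun k hk => by
    rw [div_le_iff₀ hkn, mul_comm]
    exact (hr k).trans (hR.tangential (hact k) (hrej k hk).1).1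
  have hanti : ∀ k, k₀ ≤ k → R.dF (k + 1) ≤ R.dF k := fun k hk =>
    (hR.radius_le_of_rejected (hact k) (hrej k hk)).trans
      (hR.tangential (hact k) (hrej k hk).1).2.1
  have hdrop : ∀ k, k₀ ≤ k → p.sigMin * ‖R.s k‖ ≤ R.lamF k →
      -R.dF k + (1 - p.gc) * (r / p.kn) ≤ -R.dF (k + 1) := by
    intro k hk hl
    obtain ⟨-, -, h3⟩ := (hR.fIteration k (hact k) (hrej k hk).1).2.2.2 (hrej k hk).2
    rw [h3.2 hl]
    have h1 := mul_le_mul_of_nonneg_left (hR.tangential (hact k) (hrej k hk).1).2.1 hgc0.le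
    have h2 := mul_le_mul_of_nonneg_left (hlow k hk) (sub_pos.2 hgc1).le
    linarith
  have hpos : 0 < (1 - p.gc) * (r / p.kn) := mul_pos (sub_pos.2 hgc1) (div_pos hr0 hkn)
  refine not_frequently_increment (a := fun k => -R.dF k) (B := -(r / p.kn)) (k₀ := k₀)
    (fun k hk => neg_le_neg (hanti k hk)) (fun k hk => neg_le_neg (hlow k hk)) hpos fun m => ?_
  set k := max k₀ m with hkdef
  have hk : k₀ ≤ k := le_max_left _ _
  have hm : m ≤ k := le_max_right _ _
  rcases lt_or_ge (R.lamF k) (p.sigMin * ‖R.s k‖) with hl | hl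
  -- A small multiplier at `k` forces a large one at `k + 1`, so at least one of two consecutive
  -- rejections shrinks `dF` by the fixed amount.
  · exact ⟨k + 1, by omega, hdrop (k + 1) (by omega)
      (hR.multiplier_of_rejected (hact k) (hact _) (hrej k hk) (hkeep k (hact k) (hrej k hk))
        (hrej (k + 1) (by omega)).1 hl)⟩
  · exact ⟨k, hm, hdrop k hk hl⟩

/-- The normal step passes the test that decides between taking it and expanding the radius. -/
def NormalTest (R : Trace N) (k : ℕ) : Prop :=
  R.lamV k ≤ R.sig k * ‖R.n k‖ ∨ ‖R.n k‖ = R.dMaxV k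

theorem IsRun.rejected_keeps (hR : IsRun p f c R) (hc : ContDiff ℝ 2 c)
    (hact : ∀ k, k ∈ activeSet p c R) {k : ℕ} (hF : RejectedFIteration p f c R k)
    (hkeep : R.n (k + 1) = R.n k) :
    R.lamV (k + 1) = R.lamV k ∧ (NormalTest R k → NormalTest R (k + 1)) := by
  obtain ⟨-, h1, -, h2⟩ := hR.fIteration k (hact k) hF.1
  have hx := (h2 hF.2).1
  have h3 := (hR.steps (k + 1) (hact _)).1.regMin hc
  rw [hx, hkeep] at h3
  have h4 := h3.multiplier_unique hc ((hR.steps k (hact _)).1.regMin hc) (gradV_ne_zero (hact k))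
  refine ⟨h4, ?_⟩
  rw [NormalTest, NormalTest, h4, hkeep, h1, (hR.sigma k (hact _)).1 hF.1]
  exact id

/-- After a contraction, `sig` is raised to the new ratio. After an expansion, the radius is either
`dMaxV` or `lamV / sig`; enlarging it does not increase the multiplier, so the ratio is at most
`sig` in the latter case. -/
theorem IsRun.normalTest_after (hR : IsRun p f c R) (hc : ContDiff ℝ 2 c)
    (hact : ∀ k, k ∈ activeSet p c R) {k : ℕ} (hA : ¬ Accepted p f c R k)
    (hF : ¬ IsFIteration p f c R k) : NormalTest R (k + 1) := by
  have hA' : ¬ VAccept p c R k := fun h => hA (Or.inr ⟨hF, h⟩)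
  have hσ := (hR.sigma k (hact _)).2 hF
  have hN' := (hR.steps (k + 1) (hact _)).1
  rcases lt_or_ge (rhoV c R k) p.krho with hr | hr
  · refine Or.inl ?_
    rw [← div_le_iff₀ (hR.norm_n_pos hc (hact _)), hσ.1 hr]
    exact le_max_right _ _
  · obtain ⟨-, h3, h4, hx, h6⟩ := hR.expand hc hact hF hA' hr
    have hs0 := p.sigMin_pos.trans_le (hR.sigMin_le_sig hact k)
    have hs1 := p.sigMin_pos.trans_le (hR.sigMin_le_sig hact (k + 1))
    rcases hN'.2.2.2.2.1.eq_or_lt with h0 | hpos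
    · refine Or.inl ?_
      rw [← h0]
      exact mul_nonneg hs1.le (norm_nonneg _)
    · have hn := hN'.norm_eq hpos
      have hle : R.lamV (k + 1) ≤ R.lamV k := by
        have h7 := hN'.regMin hc
        rw [hx] at h7
        exact h7.le_of_norm_le hc ((hR.steps k (hact _)).1.regMin hc) (gradV_ne_zero (hact k))
          (by rw [hn, ← h3]; exact h4)
      rcases min_choice (R.dMaxV (k + 1)) (R.lamV k / R.sig k) with hm | hm
      · exact Or.inr (by rw [hn, h6, hm])
      · refine Or.inl ?_
        rw [hn, h6, hm, hσ.2 hr, mul_div_cancel₀ _ hs0.ne']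
        exact hle

theorem IsRun.normalTest_succ (hR : IsRun p f c R) (hc : ContDiff ℝ 2 c)
    (hact : ∀ k, k ∈ activeSet p c R)
    (hkeep : ∀ k ∈ activeSet p c R, RejectedFIteration p f c R k →
      R.H (k + 1) = R.H k ∧ R.n (k + 1) = R.n k) {k : ℕ} (hA : ¬ Accepted p f c R k)
    (ht : NormalTest R k) : NormalTest R (k + 1) := by
  by_cases hF : IsFIteration p f c R k
  · have hrej : RejectedFIteration p f c R k :=
      ⟨hF, not_le.1 fun h => hA (Or.inl ⟨hF, h⟩)⟩
    exact (hR.rejected_keeps hc hact hrej (hkeep k (hact k) hrej).2).2 ht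
  · exact hR.normalTest_after hc hact hA hF

theorem IsRun.contract_of_normalTest (hR : IsRun p f c R)
    (hact : ∀ k, k ∈ activeSet p c R) {k : ℕ} (hA : ¬ Accepted p f c R k) (ht : NormalTest R k)
    (hF : ¬ IsFIteration p f c R k) : R.x (k + 1) = R.x k ∧ VContract p c R k := by
  have hr : rhoV c R k < p.krho := not_le.1 fun h => hA (Or.inr ⟨hF, h, ht⟩)
  have h := (hR.vIteration k (hact k) hF).2.2.1 hr
  exact ⟨h.1, h.2.2.2⟩

/-- A contraction gives a ratio `lamV / ‖n‖` of at least `sigMin`, and enlarges a ratio that is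
already this large by a fixed factor. -/
theorem IsRun.ratio_after_contract (hR : IsRun p f c R) (hc : ContDiff ℝ 2 c)
    (hact : ∀ k, k ∈ activeSet p c R) {k : ℕ} (hx : R.x (k + 1) = R.x k)
    (hV : VContract p c R k) :
    p.sigMin ≤ R.lamV (k + 1) / ‖R.n (k + 1)‖ ∧
      (p.sigMin ≤ R.lamV k / ‖R.n k‖ →
        min p.glam p.gc⁻¹ * (R.lamV k / ‖R.n k‖) ≤ R.lamV (k + 1) / ‖R.n (k + 1)‖) := by
  have hN := (hR.steps k (hact k)).1
  have hN' := (hR.steps (k + 1) (hact _)).1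
  have hm' := hN'.regMin hc
  rw [hx] at hm'
  have hg := gradV_ne_zero (hact k)
  have hn := hR.norm_n_pos hc (hact k)
  have hn' := hR.norm_n_pos hc (hact (k + 1))
  have hgc := p.gc_mem.1
  have hsm := p.sigMin_pos
  have hl0 := hN.2.2.2.2.1
  rcases hV.cases hc hN hg with ⟨h1, l, n, -, -, h2, h3, h4⟩ | ⟨h1, -, h2⟩
  · have hle : ‖R.n (k + 1)‖ ≤ ‖n‖ := hN'.1.trans_eq h4
    refine ⟨?_, fun h => absurd ((le_div_iff₀ hn).1 h) h1.not_ge⟩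
    rw [le_div_iff₀ hn']
    exact (mul_le_mul_of_nonneg_left hle hsm.le).trans
      (h3.trans (h2.regMin.le_of_norm_le hc hm' hg hle))
  -- Either the multiplier grows by `glam` while the norm does not increase, or the norm shrinks by
  -- `gc` while the multiplier does not decrease.
  · have hβ : min p.glam p.gc⁻¹ * (R.lamV k / ‖R.n k‖) ≤ R.lamV (k + 1) / ‖R.n (k + 1)‖ := by
      have hrad := (hV.radius_mem hc hN hg).2
      rcases h2 with ⟨n, h2, h3⟩ | h3
      · have hle : ‖R.n (k + 1)‖ ≤ ‖n‖ := hN'.1.trans_eq h3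
        have h5 := h2.regMin.le_of_norm_le hc hm' hg hle
        calc min p.glam p.gc⁻¹ * (R.lamV k / ‖R.n k‖)
            ≤ p.glam * (R.lamV k / ‖R.n k‖) := by gcongr; exact min_le_left _ _
          _ = (p.glam * R.lamV k) / ‖R.n k‖ := by ring
          _ ≤ R.lamV (k + 1) / ‖R.n (k + 1)‖ :=
              div_le_div₀ hN'.2.2.2.2.1 h5 hn' (hN'.1.trans hrad)
      · have hle : ‖R.n (k + 1)‖ ≤ p.gc * ‖R.n k‖ := hN'.1.trans_eq h3
        have h5 := (hN.regMin hc).le_of_norm_le hc hm' hg (hN'.1.trans hrad)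
        calc min p.glam p.gc⁻¹ * (R.lamV k / ‖R.n k‖)
            ≤ p.gc⁻¹ * (R.lamV k / ‖R.n k‖) := by gcongr; exact min_le_right _ _
          _ = R.lamV k / (p.gc * ‖R.n k‖) := by field_simp
          _ ≤ R.lamV (k + 1) / ‖R.n (k + 1)‖ := div_le_div₀ hN'.2.2.2.2.1 h5 hn' hle
    refine ⟨?_, fun _ => hβ⟩
    have h6 : (1 : ℝ) ≤ min p.glam p.gc⁻¹ :=
      le_min p.one_lt_glam.le ((one_le_inv₀ hgc).2 p.gc_mem.2.le)
    exact ((le_div_iff₀ hn).2 h1).trans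
      ((le_mul_of_one_le_left (div_nonneg hl0 hn.le) h6).trans hβ)

theorem IsRun.exists_not_active (hR : IsRun p f c R) (hc : ContDiff ℝ 2 c)
    (hx : ∃ K : Set (Vec N), IsCompact K ∧ ∀ k, R.x k ∈ K)
    (hkeep : ∀ k ∈ activeSet p c R, RejectedFIteration p f c R k →
      R.H (k + 1) = R.H k ∧ R.n (k + 1) = R.n k) :
    ∃ k, k ∉ activeSet p c R := by
  by_contra! hact
  obtain ⟨r, L, hr0, hb⟩ := hR.exists_normal_bounds hc hact hx
  have hr : ∀ k, r ≤ ‖R.n k‖ := fun k => (hb k).1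
  obtain ⟨k₀, hk₀⟩ := hR.eventually_not_accepted hc hact hr0 hr
  have hfreq : ∀ m, ∃ k, m ≤ k ∧ k₀ ≤ k ∧ ¬ IsFIteration p f c R k := by
    intro m
    obtain ⟨k, hk, hnr⟩ := hR.exists_not_rejected hact hkeep hr0 hr (max k₀ m)
    have hk' := (le_max_left _ _).trans hk
    exact ⟨k, (le_max_right _ _).trans hk, hk', fun hF =>
      hnr ⟨hF, not_le.1 fun h => hk₀ k hk' (Or.inl ⟨hF, h⟩)⟩⟩
  obtain ⟨k₁, -, hk₁, hF₁⟩ := hfreq 0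
  have htest : ∀ k, k₁ + 1 ≤ k → NormalTest R k := by
    intro k hk
    induction k, hk using Nat.le_induction with
    | base => exact hR.normalTest_after hc hact (hk₀ k₁ hk₁) hF₁
    | succ k hk ih => exact hR.normalTest_succ hc hact hkeep (hk₀ k (by omega)) ih
  have hstep : ∀ k, k₁ + 1 ≤ k → (¬ IsFIteration p f c R k ∧ R.x (k + 1) = R.x k ∧
      VContract p c R k) ∨ (IsFIteration p f c R k ∧
        R.lamV (k + 1) / ‖R.n (k + 1)‖ = R.lamV k / ‖R.n k‖) := by
    intro k hk
    have hA := hk₀ k (by omega)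
    by_cases hF : IsFIteration p f c R k
    · have hrej : RejectedFIteration p f c R k :=
        ⟨hF, not_le.1 fun h => hA (Or.inl ⟨hF, h⟩)⟩
      have hn := (hkeep k (hact k) hrej).2
      exact Or.inr ⟨hF, by rw [(hR.rejected_keeps hc hact hrej hn).1, hn]⟩
    · exact Or.inl ⟨hF, hR.contract_of_normalTest hact hA (htest k hk) hF⟩
  -- This second V-iteration is certainly a contraction; it lifts the ratio to `sigMin`, from where
  -- multiplicative growth gives a fixed additive increment.
  obtain ⟨k₂, hk₂, -, hF₂⟩ := hfreq (k₁ + 1)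
  have hratio : ∀ k, k₂ + 1 ≤ k → p.sigMin ≤ R.lamV k / ‖R.n k‖ := by
    intro k hk
    induction k, hk using Nat.le_induction with
    | base =>
      rcases hstep k₂ hk₂ with h | h
      · exact (hR.ratio_after_contract hc hact h.2.1 h.2.2).1
      · exact absurd h.1 hF₂
    | succ k hk ih =>
      rcases hstep k (by omega) with h | h
      · exact (hR.ratio_after_contract hc hact h.2.1 h.2.2).1
      · exact ih.trans_eq h.2.symm
  have hsm := p.sigMin_pos
  have hβ : 1 < min p.glam p.gc⁻¹ :=
    lt_min p.one_lt_glam ((one_lt_inv₀ p.gc_mem.1).2 p.gc_mem.2)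
  have hinc : ∀ k, k₂ + 1 ≤ k → ¬ IsFIteration p f c R k →
      R.lamV k / ‖R.n k‖ + (min p.glam p.gc⁻¹ - 1) * p.sigMin ≤
        R.lamV (k + 1) / ‖R.n (k + 1)‖ := by
    intro k hk hF
    rcases hstep k (by omega) with h | h
    · have h1 := hratio k hk
      have h2 := (hR.ratio_after_contract hc hact h.2.1 h.2.2).2 h1
      nlinarith
    · exact absurd h.1 hF
  have hpos : 0 < (min p.glam p.gc⁻¹ - 1) * p.sigMin := mul_pos (sub_pos.2 hβ) hsm
  have hL : 0 ≤ L := (hR.steps 0 (hact 0)).1.2.2.2.2.1.trans (hb 0).2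
  refine not_frequently_increment (a := fun k => R.lamV k / ‖R.n k‖) (k₀ := k₂ + 1) (B := L / r)
    (fun k hk => ?_) (fun k _ => div_le_div₀ hL (hb k).2 hr0 (hb k).1) hpos fun m => ?_
  · by_cases hF : IsFIteration p f c R k
    · rcases hstep k (by omega) with h | h
      · exact absurd hF h.1
      · exact h.2.ge
    · linarith [hinc k hk hF]
  · obtain ⟨k, hk, -, hF⟩ := hfreq (max m (k₂ + 1))
    exact ⟨k, (le_max_left _ _).trans hk, hinc k ((le_max_right _ _).trans hk) hF⟩

/-- The returned point is repeated, so inactivity persists and `K` is the first inactive index. -/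
theorem IsRun.activeSet_eq (hR : IsRun p f c R) (h : ∃ k, k ∉ activeSet p c R) :
    ∃ K : ℕ, activeSet p c R = {k : ℕ | k < K} := by
  classical
  refine ⟨Nat.find h, Set.ext fun k => ⟨fun hk => ?_, fun hk => not_not.1 (Nat.find_min h hk)⟩⟩
  by_contra hle
  have hle' : Nat.find h ≤ k := not_lt.1 hle
  have key : ∀ j, Nat.find h ≤ j → j ∉ activeSet p c R := by
    intro j hj
    induction j, hj using Nat.le_induction with
    | base => exact Nat.find_spec h
    | succ j hj ih =>
      intro hmem
      refine ih ?_
      have h1 : p.eps < ‖jacT c (R.x (j + 1)) (c (R.x (j + 1)))‖ := hmem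
      rwa [hR.stopped j ih] at h1
  exact key k hle' hk

end Tail

end TrustFunnel

theorem mainTheorem2 {N M : ℕ} (p : TrustFunnel.Params)
    (f : TrustFunnel.Vec N → ℝ) (c : TrustFunnel.Vec N → TrustFunnel.Vec M)
    (hf : ContDiff ℝ 2 f) (hc : ContDiff ℝ 2 c)
    (R : TrustFunnel.Trace N) (hR : TrustFunnel.IsRun p f c R)
    -- the iterates stay in a compact set and the matrices are bounded
    (hx : ∃ K : Set (TrustFunnel.Vec N), IsCompact K ∧ ∀ k, R.x k ∈ K)
    (hH : ∃ B : ℝ, ∀ k ∈ TrustFunnel.activeSet p c R, ‖R.H k‖ ≤ B)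
    -- after a rejected F-iteration the matrix and the normal step are kept
    (hkeep : ∀ k ∈ TrustFunnel.activeSet p c R, TrustFunnel.RejectedFIteration p f c R k →
      R.H (k + 1) = R.H k ∧ R.n (k + 1) = R.n k) :
    (TrustFunnel.activeSet p c R).Finite ∧
      ∃ K : ℕ, TrustFunnel.activeSet p c R = {k : ℕ | k < K} := by
  obtain ⟨K, hK⟩ := hR.activeSet_eq (hR.exists_not_active hc hx hkeep)
  exact ⟨hK ▸ Set.finite_lt_nat K, K, hK⟩
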